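/- Let $n,m\ge 1$ and $r\ge 0$. Let $M,M_d:\mathbb R^n\to\mathbb R^{n\times n}$ be symmetric positive definite matrix fields, $G:\mathbb R^n\to\mathbb R^{n\times m}$ with $\operatorname{rank}G(q)=m$ for all $q$, $J_2:\mathbb R^n\times\mathbb R^n\to\mathbb R^{n\times n}$ skew-symmetric, $K_P,K_v\in\mathbb R^{m\times m}$ symmetric positive definite, and $V_d:\mathbb R^n\to\mathbb R$ with unique global minimiser $q^\star$; $M,G,J_2$ are $C^1$ and $M_d,V_d$ are $C^2$. Put $H_d(q,p)=\tfrac12p^\top M_d^{-1}(q)p+V_d(q)$ and consider the disturbed mechanical system $$\begin{bmatrix}\dot q\\ \dot p\end{bmatrix}=\begin{bmatrix}0&M^{-1}M_d\\-M_dM^{-1}&J_2-GK_PG^\top\end{bmatrix}\nabla H_d+\begin{bmatrix}0\\G\end{bmatrix}v+\begin{bmatrix}0\\d_2\end{bmatrix},\qquad d_2=G(q)\hat d_2,$$ where the disturbance $\hat d_2(t)\in\mathbb R^m$ is measurable and locally essentially bounded, in closed loop with a $C^1$ dynamic feedback $\dot x_v=F(q,p,x_v)$, $v=\beta(q,p,x_v)$,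 $x_v\in\mathbb R^r$. Let $\mathcal K:\mathbb R^n\to\mathbb R^{n\times r}$ be $C^1$ (for instance $r=n$ and $\mathcal K=GK_iG^\top$ with $K_i=K_i^\top>0$, when $G$ is $C^1$), put $x_q=q$, $x_p=p+\mathcal K(q)x_v$, $x=(x_q,x_p,x_v)$ and $$\tilde H(x_q,x_p,x_v)=\tfrac12x_p^\top M_d^{-1}(x_q)x_p+V_d(x_q)+\tfrac12|x_v|^2,\qquad y_p=G^\top(q)M_d^{-1}(q)x_p .$$ Suppose that the feedback solves the matching problem: for $\hat d_2=0$ the closed loop, written in the coordinates $x$, is the port-Hamiltonian system $$\dot x=\big(\mathcal J(x)-\operatorname{diag}(0,\,G(x_q)K_vG^\top(x_q),\,0)\big)\nabla\tilde H(x)$$ for some skew-symmetric matrices $\mathcal J(x)=-\mathcal J(x)^\top$. Then: (i) The derivative of $\tilde H$ along the closed loop satisfies $$\dot{\tilde H}\le-\tfrac12\lambda_{\min}(K_v)\,|y_p|^2+\frac1{2\lambda_{\min}(K_v)}\,|\hat d_2|^2$$ at every state and for every value of $\hat d_2$, and hence along every (absolutely continuous) solution at almost every time $t\ge0$. (ii)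 Suppose in addition that $V_d(q)\to\infty$ as $|q|\to\infty$, and that $y_p$ is detectable when $\hat d_2\equiv0$, that is, every solution on $[0,\infty)$ of the closed loop with $\hat d_2\equiv 0$ and $y_p(t)=0$ for all $t\ge0$ satisfies $(q,p,x_v)(t)\to(q^\star,0,0)$ as $t\to\infty$. Then the closed loop is integral input-to-state stable (iISS) with respect to $\hat d_2$ at $(q^\star,0,0)$: there are $\alpha,\gamma\in\mathcal K_\infty$ and $\beta_0\in\mathcal{KL}$ such that for every initial state $z_0$ and every measurable, locally essentially bounded $\hat d_2$ the solution $z=(q,p,x_v)$ with $z(0)=z_0$ exists for all $t\ge0$ and, with $z^\star=(q^\star,0,0)$, $$\alpha(|z(t)-z^\star|)\le\beta_0(|z_0-z^\star|,t)+\int_0^t\gamma(|\hat d_2(s)|)\,ds\qquad(t\ge0).$$ -/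

import Mathlib

open MeasureTheory Filter Topology Set
open scoped Matrix

noncomputable section

/-! ## Comparison functions, solutions and integral input-to-state stability -/

/-- Class `𝒦`: continuous, strictly increasing on `[0, ∞)` and zero at zero. -/
def ClassK (α : ℝ → ℝ) : Prop :=
  ContinuousOn α (Ici 0) ∧ StrictMonoOn α (Ici 0) ∧ α 0 = 0

/-- Class `𝒦∞`: class `𝒦` and unbounded. -/
def ClassKInf (α : ℝ → ℝ) : Prop :=
  ClassK α ∧ Tendsto α atTop atTop

/-- Class `𝒦ℒ`: class `𝒦` in the first argument, decreasing to zero in the second one. -/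
def ClassKL (β : ℝ → ℝ → ℝ) : Prop :=
  (∀ t, 0 ≤ t → ClassK fun s => β s t) ∧
  (∀ s, 0 ≤ s → AntitoneOn (fun t => β s t) (Ici 0) ∧ Tendsto (fun t => β s t) atTop (𝓝 0))

/-- Admissible inputs on `[0, ∞)`: measurable and locally essentially bounded
(values at negative times play no role). -/
def AdmissibleInput {U : Type*} [NormedAddCommGroup U] [MeasurableSpace U] (u : ℝ → U) : Prop :=
  Measurable u ∧ ∀ T : ℝ, ∃ c : ℝ, ∀ᵐ t ∂(volume.restrict (Icc 0 T)), ‖u t‖ ≤ c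

/-- `z` is a (Carathéodory, i.e. absolutely continuous) solution of `ż = f (z, u)` on `[0, ∞)`. -/
def IsSolution {X U : Type*} [NormedAddCommGroup X] [NormedSpace ℝ X]
    (f : X → U → X) (u : ℝ → U) (z : ℝ → X) : Prop :=
  ContinuousOn z (Ici 0) ∧ ∀ t, 0 ≤ t → z t = z 0 + ∫ s in (0 : ℝ)..t, f (z s) (u s)

/-- The system `ż = f (z, u)` is integral input-to-state stable with respect to `u`, at the
equilibrium `ze`; `size` is the norm used on the state space.  Solutions exist for all `t ≥ 0`. -/
def IsIISS {X U : Type*} [NormedAddCommGroup X] [NormedSpace ℝ X]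
    [NormedAddCommGroup U] [MeasurableSpace U]
    (f : X → U → X) (size : X → ℝ) (ze : X) : Prop :=
  ∃ (α : ℝ → ℝ) (β : ℝ → ℝ → ℝ) (γ : ℝ → ℝ), ClassKInf α ∧ ClassKL β ∧ ClassKInf γ ∧
    ∀ (u : ℝ → U), AdmissibleInput u → ∀ z₀ : X,
      (∃ z, IsSolution f u z ∧ z 0 = z₀) ∧
      ∀ z, IsSolution f u z → z 0 = z₀ → ∀ t, 0 ≤ t →
        α (size (z t - ze)) ≤ β (size (z₀ - ze)) t + ∫ s in (0 : ℝ)..t, γ ‖u s‖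

/-- The output `y` is (zero-state) detectable for `ż = f (z, u)` with `u ≡ 0`, with respect to the
equilibrium `ze`: every solution along which the output vanishes converges to `ze`. -/
def IsDetectable {X U Y : Type*} [NormedAddCommGroup X] [NormedSpace ℝ X] [Zero U] [Zero Y]
    (f : X → U → X) (y : X → Y) (ze : X) : Prop :=
  ∀ z : ℝ → X, IsSolution f (fun _ => 0) z → (∀ t, 0 ≤ t → y (z t) = 0) →
    Tendsto z atTop (𝓝 ze)

/-! ## Linear algebra -/

/-- Euclidean space `ℝᵏ`. -/
abbrev Vec (k : ℕ) : Type := EuclideanSpace ℝ (Fin k)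

/-- Matrix times column vector. -/
def mulE {a b : ℕ} (A : Matrix (Fin a) (Fin b) ℝ) (x : Vec b) : Vec a :=
  WithLp.toLp 2 (A *ᵥ x.ofLp)

/-- Smallest eigenvalue of a symmetric matrix. -/
def lambdaMin {k : ℕ} {K : Matrix (Fin k) (Fin k) ℝ} (hK : K.IsHermitian) : ℝ :=
  ⨅ i, hK.eigenvalues i

/-! ## The mechanical system -/

/-- States `(q, p, x_v)`, and also `(x_q, x_p, x_v)`, in `ℝⁿ × ℝⁿ × ℝʳ`. -/
abbrev State (n r : ℕ) : Type := Vec n × Vec n × Vec r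

/-- Euclidean norm on the state space (the product type carries the maximum norm). -/
def stateNorm {n r : ℕ} (z : State n r) : ℝ :=
  √(‖z.1‖ ^ 2 + ‖z.2.1‖ ^ 2 + ‖z.2.2‖ ^ 2)

/-- A state written as one column vector. -/
def stack {n r : ℕ} (z : State n r) : Fin n ⊕ Fin n ⊕ Fin r → ℝ :=
  Sum.elim z.1.ofLp (Sum.elim z.2.1.ofLp z.2.2.ofLp)

/-- The data of the IDA-PBC target dynamics with `n` degrees of freedom and `m` inputs. -/
structure TargetData (n m : ℕ) where
  /-- mass matrix -/
  M : Vec n → Matrix (Fin n) (Fin n) ℝ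
  /-- desired mass matrix -/
  Md : Vec n → Matrix (Fin n) (Fin n) ℝ
  /-- input matrix -/
  G : Vec n → Matrix (Fin n) (Fin m) ℝ
  /-- free skew-symmetric matrix -/
  J₂ : Vec n → Vec n → Matrix (Fin n) (Fin n) ℝ
  /-- damping gain of the target dynamics -/
  KP : Matrix (Fin m) (Fin m) ℝ
  /-- desired potential energy -/
  Vd : Vec n → ℝ
  /-- desired position -/
  qstar : Vec n
  M_posDef : ∀ q, (M q).PosDef
  Md_posDef : ∀ q, (Md q).PosDef
  G_rank : ∀ q, (G q).rank = m
  J₂_skew : ∀ q p, (J₂ q p)ᵀ = -J₂ q p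
  KP_posDef : KP.PosDef
  /-- `qstar` is the unique global minimiser of `Vd` -/
  qstar_argmin : ∀ q, q ≠ qstar → Vd qstar < Vd q
  M_smooth : ∀ i j, ContDiff ℝ 1 fun q => M q i j
  Md_smooth : ∀ i j, ContDiff ℝ 2 fun q => Md q i j
  G_smooth : ∀ i j, ContDiff ℝ 1 fun q => G q i j
  J₂_smooth : ∀ i j, ContDiff ℝ 1 fun x : Vec n × Vec n => J₂ x.1 x.2 i j
  Vd_smooth : ContDiff ℝ 2 Vd

/-- A dynamic state feedback `ẋ_v = F (q, p, x_v)`, `v = β (q, p, x_v)`, together with the matrix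
`𝒦` that defines the new momentum coordinate `x_p = p + 𝒦(q) x_v`. -/
structure Controller (n m r : ℕ) where
  F : State n r → Vec r
  β : State n r → Vec m
  K : Vec n → Matrix (Fin n) (Fin r) ℝ
  F_smooth : ContDiff ℝ 1 F
  β_smooth : ContDiff ℝ 1 β
  K_smooth : ∀ i j, ContDiff ℝ 1 fun q => K q i j

namespace TargetData

variable {n m : ℕ} (S : TargetData n m)

/-- Desired total energy `H_d(q, p) = ½ pᵀ M_d⁻¹(q) p + V_d(q)`. -/
def Hd (q p : Vec n) : ℝ :=
  1 / 2 * inner ℝ p (mulE (S.Md q)⁻¹ p) + S.Vd q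

/-- First component of the right-hand side of the disturbed system
`(q̇, ṗ) = ℱ_d ∇H_d + (0, G v) + (d₁, d₂)`. -/
def qdot (q p d₁ : Vec n) : Vec n :=
  mulE ((S.M q)⁻¹ * S.Md q) (gradient (fun p' => S.Hd q p') p) + d₁

/-- Second component of the right-hand side of the disturbed system. -/
def pdot (q p : Vec n) (v : Vec m) (d₂ : Vec n) : Vec n :=
  mulE (-(S.Md q * (S.M q)⁻¹)) (gradient (fun q' => S.Hd q' p) q)
    + mulE (S.J₂ q p - S.G q * S.KP * (S.G q)ᵀ) (gradient (fun p' => S.Hd q p') p)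
    + mulE (S.G q) v + d₂

/-- The energy `H̃(x_q, x_p, x_v) = ½ x_pᵀ M_d⁻¹(x_q) x_p + V_d(x_q) + ½ |x_v|²`. -/
def Htilde {r : ℕ} (x : State n r) : ℝ :=
  S.Hd x.1 x.2.1 + 1 / 2 * ‖x.2.2‖ ^ 2

/-- The gradient of `H̃`, by blocks. -/
def gradHtilde {r : ℕ} (x : State n r) : State n r :=
  (gradient (fun a => S.Htilde (a, x.2.1, x.2.2)) x.1,
   gradient (fun b => S.Htilde (x.1, b, x.2.2)) x.2.1,
   gradient (fun c => S.Htilde (x.1, x.2.1, c)) x.2.2)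

/-- The damping matrix `diag(0, G K_v Gᵀ, 0)`. -/
def damping (r : ℕ) (Kv : Matrix (Fin m) (Fin m) ℝ) (q : Vec n) :
    Matrix (Fin n ⊕ Fin n ⊕ Fin r) (Fin n ⊕ Fin n ⊕ Fin r) ℝ :=
  Matrix.fromBlocks 0 0 0 (Matrix.fromBlocks (S.G q * Kv * (S.G q)ᵀ) 0 0 0)

end TargetData

namespace Controller

variable {n m r : ℕ} (C : Controller n m r) (S : TargetData n m)

/-- The change of coordinates `(q, p, x_v) ↦ (x_q, x_p, x_v) = (q, p + 𝒦(q) x_v, x_v)`. -/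
def coord (z : State n r) : State n r :=
  (z.1, z.2.1 + mulE (C.K z.1) z.2.2, z.2.2)

/-- The disturbed system in closed loop with the controller, with `d₁ = 0` and the matched
disturbance `d₂ = G(q) d`. -/
def closedLoop (z : State n r) (d : Vec m) : State n r :=
  (S.qdot z.1 z.2.1 0, S.pdot z.1 z.2.1 (C.β z) (mulE (S.G z.1) d), C.F z)

/-- The controller solves the matching problem: in the coordinates `x = (x_q, x_p, x_v)` the
undisturbed closed loop is the port-Hamiltonian system
`ẋ = (𝒥(x) - diag(0, G K_v Gᵀ, 0)) ∇H̃(x)`. -/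
def SolvesMatching (Kv : Matrix (Fin m) (Fin m) ℝ)
    (𝒥 : State n r → Matrix (Fin n ⊕ Fin n ⊕ Fin r) (Fin n ⊕ Fin n ⊕ Fin r) ℝ) : Prop :=
  ∀ z : State n r,
    stack (fderiv ℝ C.coord z (C.closedLoop S z 0)) =
      (𝒥 (C.coord z) - S.damping r Kv z.1) *ᵥ stack (S.gradHtilde (C.coord z))

/-- The output `y_p = Gᵀ M_d⁻¹ x_p`, as a function of `(q, p, x_v)`. -/
def yp (z : State n r) : Vec m :=
  mulE ((S.G z.1)ᵀ * (S.Md z.1)⁻¹) (C.coord z).2.1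

end Controller

end

/-!
The dissipation inequality is an energy balance.  In the coordinates `x` the skew-symmetric part of
the port-Hamiltonian structure does no work, the damping extracts `y_pᵀ K_v y_p`, and the matched
disturbance supplies the power `y_pᵀ d` (`Controller.fderiv_Htilde_coord_closedLoop`); Young's
inequality gives the claim.  Solutions are Lipschitz on compact time intervals, because admissible
inputs are locally essentially bounded, so that the inequality holds almost everywhere along
solutions and can be integrated (`IsSolutionOn.dissipation`).

Integral input-to-state stability holds for every control-affine system `ż = f₀(z) + g(z) u` with a
proper storage function `V`, `V̇ ≤ -ρ + C ‖u‖²`, whose rate `ρ` is detectable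
(`IsProperStorage.isIISS`).  No converse Lyapunov theorem is needed; the argument works with
trajectories and with the gain `γ(r) = C r² + r`.

* Solutions exist for all times: a bump function makes the vector field globally Lipschitz without
  destroying the dissipation inequality, and the inequality keeps the solution in a sublevel set of
  `V` where the bump function is one (`exists_isSolutionOn`).
* By LaSalle's invariance argument `V` tends to zero along undisturbed solutions
  (`IsProperStorage.exists_storage_lt`).  Grönwall's inequality and compactness make this uniform
  and robust: in every sublevel set there are `T` and `δ` such that an input with
  `∫ ‖u‖ ≤ δ` on a window of length `T` cannot prevent `V` from dropping below `ε` on it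
  (`IsProperStorage.exists_uniform_window`).
* Let `V(z(0)) ≤ c` and `J(t) = ∫₀ᵗ γ(‖u‖)`.  If `J(t) ≥ c`, then `V(z(t)) ≤ c + J(t) ≤ 2 J(t)`.
  Otherwise `z` stays in `{V ≤ 2 c}`, and among more than `c / δ` consecutive windows one has
  `∫ ‖u‖ ≤ δ`; after it, `V(z(t)) ≤ ε + J(t)`.  In both cases `V(z(t)) / 2 ≤ ε + J(t)` for all `t`
  beyond a time which depends only on `c` and `ε`
  (`IsProperStorage.exists_time_half_storage_le`).
* The supremum of `V(z(τ)) / 2 - J(τ)` over all inputs, all initial states of size at most `s` and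
  all times `τ ≥ t` is therefore finite, small for small `s`, and tends to zero as `t → ∞`.  It is
  dominated by a class `𝒦ℒ` function (`exists_classKL_ge`), and `V / 2` dominates a class `𝒦∞`
  function of the size (`exists_classKInf_comp_le`).
-/

/-! ### Admissible inputs -/

section Inputs

variable {U : Type*} [NormedAddCommGroup U] [MeasurableSpace U]

theorem admissibleInput_zero : AdmissibleInput (fun _ : ℝ => (0 : U)) :=
  ⟨measurable_const, fun _ => ⟨0, by simp⟩⟩

theorem AdmissibleInput.exists_bound {u : ℝ → U} (hu : AdmissibleInput u) (T : ℝ) :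
    ∃ c : ℝ, 0 ≤ c ∧ ∀ᵐ t, t ∈ Icc 0 T → ‖u t‖ ≤ c := by
  obtain ⟨c, hc⟩ := hu.2 T
  refine ⟨max c 0, le_max_right _ _, ?_⟩
  rw [ae_restrict_iff' measurableSet_Icc] at hc
  filter_upwards [hc] with t ht htT using (ht htT).trans (le_max_left _ _)

theorem AdmissibleInput.shift {u : ℝ → U} (hu : AdmissibleInput u) {a : ℝ} (ha : 0 ≤ a) :
    AdmissibleInput fun t => u (t + a) := by
  refine ⟨hu.1.comp (measurable_id.add_const a), fun T => ?_⟩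
  obtain ⟨c, -, hc⟩ := hu.exists_bound (T + a)
  refine ⟨c, ?_⟩
  rw [ae_restrict_iff' measurableSet_Icc]
  have := (measurePreserving_add_right (volume : Measure ℝ) a).quasiMeasurePreserving.ae hc
  filter_upwards [this] with t ht htT
  exact ht ⟨by linarith [htT.1], by linarith [htT.2]⟩

variable [BorelSpace U]

theorem AdmissibleInput.intervalIntegrable_comp_norm {u : ℝ → U} (hu : AdmissibleInput u)
    {φ : ℝ → ℝ} (hφ : Continuous φ) {a b : ℝ} (ha : 0 ≤ a) (hb : 0 ≤ b) :
    IntervalIntegrable (fun t => φ ‖u t‖) volume a b := by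
  obtain ⟨c, hc0, hc⟩ := hu.exists_bound (max a b)
  obtain ⟨D, hD⟩ := isCompact_Icc.exists_bound_of_continuousOn (s := Icc 0 c) hφ.continuousOn
  rw [intervalIntegrable_iff]
  refine Measure.integrableOn_of_bounded (M := D) (by simp [uIoc]) ?_ ?_
  · exact (hφ.measurable.comp hu.1.norm).aestronglyMeasurable
  · rw [ae_restrict_iff' measurableSet_uIoc]
    filter_upwards [hc] with t ht htab
    refine hD _ ⟨norm_nonneg _, ht ⟨(le_min ha hb).trans htab.1.le, htab.2⟩⟩

end Inputs

/-! ### Solutions of control-affine systems -/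

/-- The right-hand side `f₀(x) + g(x) u` of a control-affine system. -/
def affineField {X U : Type*} [NormedAddCommGroup X] [NormedSpace ℝ X] [NormedAddCommGroup U]
    [NormedSpace ℝ U] (f₀ : X → X) (g : X → U →L[ℝ] X) (x : X) (u : U) : X :=
  f₀ x + g x u

/-- Carathéodory solutions of `ż = f (z, u)` on the compact interval `[0, T]`. -/
def IsSolutionOn {X U : Type*} [NormedAddCommGroup X] [NormedSpace ℝ X]
    (f : X → U → X) (u : ℝ → U) (T : ℝ) (z : ℝ → X) : Prop :=
  ContinuousOn z (Icc 0 T) ∧ ∀ t ∈ Icc 0 T, z t = z 0 + ∫ s in (0 : ℝ)..t, f (z s) (u s)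

section Solutions

variable {X U : Type*} [NormedAddCommGroup X] [NormedSpace ℝ X]

theorem IsSolution.isSolutionOn {f : X → U → X} {u : ℝ → U} {z : ℝ → X}
    (hz : IsSolution f u z) (T : ℝ) : IsSolutionOn f u T z :=
  ⟨hz.1.mono Icc_subset_Ici_self, fun t ht => hz.2 t ht.1⟩

theorem IsSolutionOn.mono {f : X → U → X} {u : ℝ → U} {z : ℝ → X} {T T' : ℝ}
    (hz : IsSolutionOn f u T z) (h : T' ≤ T) : IsSolutionOn f u T' z :=
  ⟨hz.1.mono (Icc_subset_Icc_right h), fun t ht => hz.2 t ⟨ht.1, ht.2.trans h⟩⟩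

theorem isSolution_iff_forall_isSolutionOn {f : X → U → X} {u : ℝ → U} {z : ℝ → X} :
    IsSolution f u z ↔ ∀ T, IsSolutionOn f u T z := by
  refine ⟨fun h => h.isSolutionOn, fun h => ⟨fun t ht => ?_, fun t ht => (h t).2 t ⟨ht, le_rfl⟩⟩⟩
  have h1 := (h (t + 1)).1 t ⟨ht, by linarith⟩
  refine h1.mono_of_mem_nhdsWithin ?_
  rw [← Ici_inter_Iic]
  exact inter_mem_nhdsWithin _ (Iic_mem_nhds (by linarith))

variable [NormedAddCommGroup U] [NormedSpace ℝ U] [MeasurableSpace U] [BorelSpace U]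
  [SecondCountableTopology U]
variable {f₀ : X → X} {g : X → U →L[ℝ] X} {u : ℝ → U} {z : ℝ → X} {T : ℝ}

/-- Along a continuous curve the right-hand side is measurable and essentially bounded. -/
theorem affineField_ae_bound_of_continuousOn (hf : Continuous f₀) (hg : Continuous g)
    (hu : AdmissibleInput u) (hz : ContinuousOn z (Icc 0 T)) :
    AEStronglyMeasurable (fun s => affineField f₀ g (z s) (u s)) (volume.restrict (Icc 0 T)) ∧
    ∃ B : ℝ, 0 ≤ B ∧ ∀ᵐ t, t ∈ Icc 0 T → ‖affineField f₀ g (z t) (u t)‖ ≤ B := by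
  constructor
  · have h1 : AEStronglyMeasurable (fun s => f₀ (z s)) (volume.restrict (Icc 0 T)) :=
      (hf.comp_continuousOn hz).aestronglyMeasurable measurableSet_Icc
    have h2 : AEStronglyMeasurable (fun s => g (z s)) (volume.restrict (Icc 0 T)) :=
      (hg.comp_continuousOn hz).aestronglyMeasurable measurableSet_Icc
    have h3 : AEStronglyMeasurable u (volume.restrict (Icc 0 T)) :=
      hu.1.aestronglyMeasurable
    exact h1.add (isBoundedBilinearMap_apply.continuous.comp_aestronglyMeasurable₂ h2 h3)
  · obtain ⟨c, hc0, hc⟩ := hu.exists_bound T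
    obtain ⟨B₁, hB₁⟩ := isCompact_Icc.exists_bound_of_continuousOn (hf.comp_continuousOn hz)
    obtain ⟨B₂, hB₂⟩ := isCompact_Icc.exists_bound_of_continuousOn (hg.comp_continuousOn hz)
    refine ⟨|B₁| + |B₂| * c, by positivity, ?_⟩
    filter_upwards [hc] with t ht htT
    refine (norm_add_le _ _).trans ?_
    refine add_le_add ((hB₁ t htT).trans (le_abs_self _))
      ((ContinuousLinearMap.le_opNorm _ _).trans ?_)
    exact mul_le_mul ((hB₂ t htT).trans (le_abs_self _)) (ht htT) (norm_nonneg _) (abs_nonneg _)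

theorem intervalIntegrable_affineField (hf : Continuous f₀) (hg : Continuous g)
    (hu : AdmissibleInput u) (hz : ContinuousOn z (Icc 0 T)) {a b : ℝ} (ha : a ∈ Icc 0 T)
    (hb : b ∈ Icc 0 T) :
    IntervalIntegrable (fun s => affineField f₀ g (z s) (u s)) volume a b := by
  obtain ⟨hm, B, -, hB⟩ := affineField_ae_bound_of_continuousOn hf hg hu hz
  have : IntegrableOn (fun s => affineField f₀ g (z s) (u s)) (Icc 0 T) := by
    refine Integrable.of_bound hm B ?_
    rwa [ae_restrict_iff' measurableSet_Icc]
  rw [intervalIntegrable_iff]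
  exact this.mono_set (uIoc_subset_uIcc.trans (uIcc_subset_Icc ha hb))

theorem IsSolutionOn.sub_eq_integral (hz : IsSolutionOn (affineField f₀ g) u T z)
    (hf : Continuous f₀) (hg : Continuous g) (hu : AdmissibleInput u) {a b : ℝ}
    (ha : a ∈ Icc 0 T) (hb : b ∈ Icc 0 T) :
    z b - z a = ∫ s in a..b, affineField f₀ g (z s) (u s) := by
  have h0 : (0 : ℝ) ∈ Icc 0 T := ⟨le_rfl, ha.1.trans ha.2⟩
  have hi := fun {a b} => intervalIntegrable_affineField (a := a) (b := b) hf hg hu hz.1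
  rw [hz.2 a ha, hz.2 b hb, ← intervalIntegral.integral_add_adjacent_intervals (hi h0 ha) (hi ha hb)]
  abel

theorem IsSolutionOn.exists_lipschitzOnWith (hz : IsSolutionOn (affineField f₀ g) u T z)
    (hf : Continuous f₀) (hg : Continuous g) (hu : AdmissibleInput u) :
    ∃ L, LipschitzOnWith L z (Icc 0 T) := by
  obtain ⟨-, B, hB0, hB⟩ := affineField_ae_bound_of_continuousOn hf hg hu hz.1
  refine ⟨⟨B, hB0⟩, LipschitzOnWith.of_dist_le_mul fun a ha b hb => ?_⟩
  rw [dist_comm, dist_eq_norm, hz.sub_eq_integral hf hg hu ha hb, dist_comm, Real.dist_eq]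
  refine intervalIntegral.norm_integral_le_of_norm_le_const_ae ?_
  filter_upwards [hB] with t ht hab
  exact ht (uIcc_subset_Icc ha hb (uIoc_subset_uIcc hab))

theorem IsSolution.shift {z : ℝ → X} (hz : IsSolution (affineField f₀ g) u z)
    (hf : Continuous f₀) (hg : Continuous g) (hu : AdmissibleInput u) {a : ℝ} (ha : 0 ≤ a) :
    IsSolution (affineField f₀ g) (fun t => u (t + a)) fun t => z (t + a) := by
  constructor
  · refine hz.1.comp (by fun_prop) fun t ht => ?_
    exact add_nonneg ht ha
  · intro t ht
    have := (hz.isSolutionOn (t + a)).sub_eq_integral hf hg hu (a := a) (b := t + a)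
      ⟨ha, by linarith⟩ ⟨by linarith, le_rfl⟩
    rw [intervalIntegral.integral_comp_add_right
      (fun s => affineField f₀ g (z s) (u s)), zero_add, ← this]
    simp

variable [CompleteSpace X]

theorem IsSolutionOn.ae_hasDerivAt (hz : IsSolutionOn (affineField f₀ g) u T z)
    (hf : Continuous f₀) (hg : Continuous g) (hu : AdmissibleInput u) :
    ∀ᵐ t, t ∈ Ioo 0 T → HasDerivAt z (affineField f₀ g (z t) (u t)) t := by
  rcases le_or_gt T 0 with hT | hT
  · simp [Ioo_eq_empty hT.not_gt]
  have h0 : (0 : ℝ) ∈ Icc 0 T := ⟨le_rfl, hT.le⟩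
  filter_upwards [(intervalIntegrable_affineField hf hg hu hz.1 h0
    ⟨hT.le, le_rfl⟩).ae_hasDerivAt_integral] with t ht htT
  have h1 := ht (by rw [uIcc_of_le hT.le]; exact Ioo_subset_Icc_self htT) 0 (by simp)
  refine (h1.const_add (z 0)).congr_of_eventuallyEq ?_
  filter_upwards [Ioo_mem_nhds htT.1 htT.2] with s hs
  exact hz.2 s (Ioo_subset_Icc_self hs)

/-- The fundamental theorem of calculus for a `C¹` function along a solution.  It holds because
solutions are Lipschitz on compact intervals. -/
theorem IsSolutionOn.integral_fderiv_eq_sub (hz : IsSolutionOn (affineField f₀ g) u T z)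
    (hf : Continuous f₀) (hg : Continuous g) (hu : AdmissibleInput u) {V : X → ℝ}
    (hV : ContDiff ℝ 1 V) {a b : ℝ} (ha : a ∈ Icc 0 T) (hb : b ∈ Icc 0 T) :
    IntervalIntegrable (fun s => fderiv ℝ V (z s) (affineField f₀ g (z s) (u s))) volume a b ∧
    ∫ s in a..b, fderiv ℝ V (z s) (affineField f₀ g (z s) (u s)) = V (z b) - V (z a) := by
  obtain ⟨L, hL⟩ := hz.exists_lipschitzOnWith hf hg hu
  have hK : IsCompact (z '' Icc 0 T) := isCompact_Icc.image_of_continuousOn hz.1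
  obtain ⟨L', hL'⟩ := LocallyLipschitzOn.exists_lipschitzOnWith_of_compact hK
    (hV.locallyLipschitz.locallyLipschitzOn (s := z '' Icc 0 T))
  have hVz := hL'.comp hL (mapsTo_image _ _)
  have hac : AbsolutelyContinuousOnInterval (V ∘ z) a b :=
    (hVz.mono (uIcc_subset_Icc ha hb)).absolutelyContinuousOnInterval
  have hne : ∀ᵐ t : ℝ, t ≠ 0 ∧ t ≠ T := by
    have h₁ : ∀ᵐ x : ℝ, x ≠ 0 := by simp [ae_iff, measure_singleton]
    have h₂ : ∀ᵐ x : ℝ, x ≠ T := by simp [ae_iff, measure_singleton]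
    filter_upwards [h₁, h₂] with t h1 h2 using ⟨h1, h2⟩
  have hae : ∀ᵐ t, t ∈ uIoc a b →
      deriv (V ∘ z) t = fderiv ℝ V (z t) (affineField f₀ g (z t) (u t)) := by
    filter_upwards [hz.ae_hasDerivAt hf hg hu, hne] with t ht htne htab
    have hm := uIcc_subset_Icc ha hb (uIoc_subset_uIcc htab)
    have := ht ⟨lt_of_le_of_ne hm.1 htne.1.symm, lt_of_le_of_ne hm.2 htne.2⟩
    exact (((hV.differentiable one_ne_zero) (z t)).hasFDerivAt.comp_hasDerivAt t this).deriv
  refine ⟨hac.intervalIntegrable_deriv.congr_ae ?_, ?_⟩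
  · rwa [EventuallyEq, ae_restrict_iff' measurableSet_uIoc]
  · rw [← intervalIntegral.integral_congr_ae hae, hac.integral_deriv_eq_sub]
    rfl

/-- A dissipation inequality for the vector field, integrated along a solution. -/
theorem IsSolutionOn.dissipation (hz : IsSolutionOn (affineField f₀ g) u T z)
    (hf : Continuous f₀) (hg : Continuous g) (hu : AdmissibleInput u) {V ρ : X → ℝ} {C : ℝ}
    (hV : ContDiff ℝ 1 V) (hρ : Continuous ρ)
    (hd : ∀ x v, fderiv ℝ V x (affineField f₀ g x v) ≤ -ρ x + C * ‖v‖ ^ 2) {a b : ℝ}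
    (ha : 0 ≤ a) (hab : a ≤ b) (hb : b ≤ T) :
    V (z b) + ∫ s in a..b, ρ (z s) ≤ V (z a) + ∫ s in a..b, C * ‖u s‖ ^ 2 := by
  obtain ⟨hi, he⟩ := hz.integral_fderiv_eq_sub hf hg hu hV ⟨ha, hab.trans hb⟩ ⟨ha.trans hab, hb⟩
  have h1 : IntervalIntegrable (fun s => ρ (z s)) volume a b := by
    refine ContinuousOn.intervalIntegrable ((hρ.comp_continuousOn hz.1).mono ?_)
    rw [uIcc_of_le hab]
    exact Icc_subset_Icc ha hb
  have h2 : IntervalIntegrable (fun s => C * ‖u s‖ ^ 2) volume a b :=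
    hu.intervalIntegrable_comp_norm (φ := fun r => C * r ^ 2) (by fun_prop) ha (ha.trans hab)
  have := intervalIntegral.integral_mono_on hab hi (h1.neg.add h2) (fun s _ => hd (z s) (u s))
  rw [intervalIntegral.integral_add h1.neg h2, he] at this
  simp only [Pi.neg_apply, intervalIntegral.integral_neg] at this
  linarith

end Solutions

/-! ### Grönwall's inequality and dependence on data -/

/-- Grönwall's inequality in integral form. -/
theorem le_mul_exp_of_le_add_mul_integral {φ : ℝ → ℝ} {A L T : ℝ} (hφ : ContinuousOn φ (Icc 0 T))
    (hL : 0 ≤ L) (h : ∀ t ∈ Icc 0 T, φ t ≤ A + L * ∫ s in (0 : ℝ)..t, φ s) :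
    ∀ t ∈ Icc 0 T, φ t ≤ A * Real.exp (L * t) := by
  intro t ht
  -- extend `φ` continuously to the line, so that its primitive is differentiable everywhere
  have hT : (0 : ℝ) ≤ T := ht.1.trans ht.2
  let ψ : ℝ → ℝ := IccExtend hT ((Icc 0 T).domRestrict φ)
  have hψ : Continuous ψ := (continuousOn_iff_continuous_domRestrict.1 hφ).Icc_extend'
  have hψe : ∀ s ∈ Icc 0 T, ψ s = φ s := fun s hs => by
    simp [ψ, IccExtend_of_mem hT _ hs, domRestrict]
  have hint : ∀ s ∈ Icc 0 T, ∫ r in (0 : ℝ)..s, φ r = ∫ r in (0 : ℝ)..s, ψ r := by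
    intro s hs
    refine intervalIntegral.integral_congr fun r hr => (hψe r ?_).symm
    rw [uIcc_of_le hs.1] at hr
    exact ⟨hr.1, hr.2.trans hs.2⟩
  let E : ℝ → ℝ := fun s => A + L * ∫ r in (0 : ℝ)..s, ψ r
  have hE : ∀ s, HasDerivAt E (L * ψ s) s := fun s =>
    ((intervalIntegral.integral_hasDerivAt_right (hψ.intervalIntegrable _ _)
      hψ.stronglyMeasurable.stronglyMeasurableAtFilter hψ.continuousAt).const_mul L).const_add A
  -- `E(s) exp(-L s)` is antitone
  have hanti : AntitoneOn (fun s => E s * Real.exp (-(L * s))) (Icc 0 T) := by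
    have hd : ∀ s, HasDerivAt (fun s => E s * Real.exp (-(L * s)))
        (L * ψ s * Real.exp (-(L * s)) + E s * (Real.exp (-(L * s)) * -(L * 1))) s := fun s =>
      (hE s).mul ((((hasDerivAt_id s).const_mul L).neg).exp)
    refine antitoneOn_of_deriv_nonpos (convex_Icc _ _)
      (fun s _ => (hd s).continuousAt.continuousWithinAt)
      (fun s _ => (hd s).differentiableAt.differentiableWithinAt) fun s hs => ?_
    have hs' := interior_subset hs
    rw [(hd s).deriv]
    have h1 : ψ s ≤ E s := by
      have := h s hs'
      rwa [hint s hs', ← hψe s hs'] at this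
    have h2 := mul_nonneg hL (mul_nonneg (sub_nonneg.2 h1) (Real.exp_pos (-(L * s))).le)
    nlinarith
  have h1 := hanti ⟨le_rfl, hT⟩ ht ht.1
  have h2 : φ t ≤ E t := by
    have := h t ht
    rwa [hint t ht] at this
  simp only [E, intervalIntegral.integral_same, mul_zero, add_zero, neg_zero, Real.exp_zero,
    mul_one] at h1
  refine h2.trans ?_
  have h3 := mul_le_mul_of_nonneg_right h1 (Real.exp_pos (L * t)).le
  rwa [mul_assoc, ← Real.exp_add, neg_add_cancel, Real.exp_zero, mul_one] at h3

section Comparison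

variable {X U : Type*} [NormedAddCommGroup X] [NormedSpace ℝ X] [NormedAddCommGroup U]
  [NormedSpace ℝ U]
variable {f₀ : X → X} {g : X → U →L[ℝ] X} {u v : ℝ → U} {z w : ℝ → X} {T : ℝ}

theorem exists_lipschitz_on_compact (hf : ContDiff ℝ 1 f₀) (hg : ContDiff ℝ 1 g) {K : Set X}
    (hK : IsCompact K) :
    ∃ L₀ L₁ : ℝ, 0 ≤ L₀ ∧ 0 ≤ L₁ ∧ (∀ x ∈ K, ∀ y ∈ K, ‖f₀ x - f₀ y‖ ≤ L₀ * ‖x - y‖) ∧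
      ∀ x ∈ K, ∀ y ∈ K, ‖g x - g y‖ ≤ L₁ * ‖x - y‖ := by
  obtain ⟨L₀, h₀⟩ := LocallyLipschitzOn.exists_lipschitzOnWith_of_compact hK
    (hf.locallyLipschitz.locallyLipschitzOn (s := K))
  obtain ⟨L₁, h₁⟩ := LocallyLipschitzOn.exists_lipschitzOnWith_of_compact hK
    (hg.locallyLipschitz.locallyLipschitzOn (s := K))
  exact ⟨L₀, L₁, L₀.2, L₁.2, fun x hx y hy => h₀.norm_sub_le hx hy,
    fun x hx y hy => h₁.norm_sub_le hx hy⟩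

variable [MeasurableSpace U] [BorelSpace U] [SecondCountableTopology U]

/-- Two solutions stay close if their right-hand sides do, up to a multiple of the input `u`. -/
theorem IsSolutionOn.norm_sub_le (hz : IsSolutionOn (affineField f₀ g) u T z)
    (hw : IsSolutionOn (affineField f₀ g) v T w) (hf : Continuous f₀) (hg : Continuous g)
    (hu : AdmissibleInput u) (hv : AdmissibleInput v) {L B : ℝ} (hL : 0 ≤ L) (hB : 0 ≤ B)
    (h : ∀ᵐ s, s ∈ Icc 0 T → ‖affineField f₀ g (z s) (u s) - affineField f₀ g (w s) (v s)‖ ≤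
      L * ‖z s - w s‖ + B * ‖u s‖) :
    ∀ t ∈ Icc 0 T, ‖z t - w t‖ ≤
      (‖z 0 - w 0‖ + B * ∫ s in (0 : ℝ)..T, ‖u s‖) * Real.exp (L * t) := by
  have hc : ContinuousOn (fun t => ‖z t - w t‖) (Icc 0 T) := (hz.1.sub hw.1).norm
  refine le_mul_exp_of_le_add_mul_integral hc hL fun t ht => ?_
  have hT : (0 : ℝ) ≤ T := ht.1.trans ht.2
  have h0 : (0 : ℝ) ∈ Icc 0 T := ⟨le_rfl, hT⟩
  have hiu : ∀ {a b : ℝ}, 0 ≤ a → 0 ≤ b → IntervalIntegrable (fun s => ‖u s‖) volume a b :=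
    fun ha hb => hu.intervalIntegrable_comp_norm continuous_id ha hb
  have e : z t - w t = (z 0 - w 0) + ∫ s in (0 : ℝ)..t,
      (affineField f₀ g (z s) (u s) - affineField f₀ g (w s) (v s)) := by
    rw [intervalIntegral.integral_sub (intervalIntegrable_affineField hf hg hu hz.1 h0 ht)
      (intervalIntegrable_affineField hf hg hv hw.1 h0 ht), hz.2 t ht, hw.2 t ht]
    abel
  have hci : IntervalIntegrable (fun s => ‖z s - w s‖) volume 0 t := by
    refine (hc.mono ?_).intervalIntegrable
    rw [uIcc_of_le ht.1]
    exact Icc_subset_Icc_right ht.2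
  have h1 : ‖∫ s in (0 : ℝ)..t,
      (affineField f₀ g (z s) (u s) - affineField f₀ g (w s) (v s))‖ ≤
      ∫ s in (0 : ℝ)..t, (L * ‖z s - w s‖ + B * ‖u s‖) := by
    refine intervalIntegral.norm_integral_le_of_norm_le ht.1 ?_
      ((hci.const_mul L).add ((hiu le_rfl ht.1).const_mul B))
    filter_upwards [h] with s hs hst using hs ⟨hst.1.le, hst.2.trans ht.2⟩
  rw [intervalIntegral.integral_add (hci.const_mul L) ((hiu le_rfl ht.1).const_mul B),
    intervalIntegral.integral_const_mul, intervalIntegral.integral_const_mul] at h1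
  have h2 : ∫ s in (0 : ℝ)..t, ‖u s‖ ≤ ∫ s in (0 : ℝ)..T, ‖u s‖ := by
    rw [← intervalIntegral.integral_add_adjacent_intervals (hiu le_rfl ht.1) (hiu ht.1 hT)]
    linarith [intervalIntegral.integral_nonneg (μ := volume) ht.2 fun s _ => norm_nonneg (u s)]
  have h3 := mul_le_mul_of_nonneg_left h2 hB
  rw [e]
  linarith [norm_add_le (z 0 - w 0) (∫ s in (0 : ℝ)..t,
      (affineField f₀ g (z s) (u s) - affineField f₀ g (w s) (v s)))]

theorem IsSolutionOn.eqOn (hz : IsSolutionOn (affineField f₀ g) u T z)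
    (hw : IsSolutionOn (affineField f₀ g) u T w) (hf : ContDiff ℝ 1 f₀) (hg : ContDiff ℝ 1 g)
    (hu : AdmissibleInput u) (h0 : z 0 = w 0) : EqOn z w (Icc 0 T) := by
  have hK : IsCompact (z '' Icc 0 T ∪ w '' Icc 0 T) :=
    (isCompact_Icc.image_of_continuousOn hz.1).union (isCompact_Icc.image_of_continuousOn hw.1)
  obtain ⟨L₀, L₁, hL₀, hL₁, h₀, h₁⟩ := exists_lipschitz_on_compact hf hg hK
  obtain ⟨c, hc0, hc⟩ := hu.exists_bound T
  intro t ht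
  have := hz.norm_sub_le hw hf.continuous hg.continuous hu hu
    (L := L₀ + L₁ * c) (B := 0) (by positivity) le_rfl ?_ t ht
  · simpa [h0, sub_eq_zero] using this
  · filter_upwards [hc] with s hs hsT
    have hzs : z s ∈ z '' Icc 0 T ∪ w '' Icc 0 T := Or.inl (mem_image_of_mem _ hsT)
    have hws : w s ∈ z '' Icc 0 T ∪ w '' Icc 0 T := Or.inr (mem_image_of_mem _ hsT)
    have e : affineField f₀ g (z s) (u s) - affineField f₀ g (w s) (u s) =
        (f₀ (z s) - f₀ (w s)) + (g (z s) - g (w s)) (u s) := by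
      simp only [affineField, sub_apply]
      abel
    rw [e, zero_mul, add_zero, add_mul]
    refine (norm_add_le _ _).trans (add_le_add (h₀ _ hzs _ hws) ?_)
    refine ((g (z s) - g (w s)).le_opNorm _).trans ?_
    refine (mul_le_mul (h₁ _ hzs _ hws) (hs hsT) (norm_nonneg _) (by positivity)).trans_eq ?_
    ring

/-- Continuous dependence: inside a compact set, a solution with input `u` stays near a solution
of the undisturbed system, with an error governed by the initial error and the `L¹` norm of `u`. -/
theorem exists_norm_sub_le_of_mem_compact (hf : ContDiff ℝ 1 f₀) (hg : ContDiff ℝ 1 g) {K : Set X}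
    (hK : IsCompact K) :
    ∃ L B : ℝ, 0 ≤ L ∧ 0 ≤ B ∧ ∀ (T : ℝ) (u : ℝ → U) (z w : ℝ → X), AdmissibleInput u →
      IsSolutionOn (affineField f₀ g) u T z → IsSolutionOn (affineField f₀ g) (fun _ => 0) T w →
      (∀ t ∈ Icc 0 T, z t ∈ K) → (∀ t ∈ Icc 0 T, w t ∈ K) → ∀ t ∈ Icc 0 T,
        ‖z t - w t‖ ≤ (‖z 0 - w 0‖ + B * ∫ s in (0 : ℝ)..T, ‖u s‖) * Real.exp (L * t) := by
  obtain ⟨L₀, L₁, hL₀, hL₁, h₀, h₁⟩ := exists_lipschitz_on_compact hf hg hK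
  obtain ⟨B, hB⟩ := hK.exists_bound_of_continuousOn hg.continuous.continuousOn
  refine ⟨L₀, |B|, hL₀, abs_nonneg _, fun T u z w hu hz hw hzK hwK => ?_⟩
  refine hz.norm_sub_le hw hf.continuous hg.continuous hu admissibleInput_zero hL₀
    (abs_nonneg _) (Eventually.of_forall fun s hs => ?_)
  have e : affineField f₀ g (z s) (u s) - affineField f₀ g (w s) 0 =
      (f₀ (z s) - f₀ (w s)) + (g (z s)) (u s) := by
    simp only [affineField, map_zero]
    abel
  rw [e]
  refine (norm_add_le _ _).trans (add_le_add (h₀ _ (hzK s hs) _ (hwK s hs)) ?_)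
  refine ((g (z s)).le_opNorm _).trans ?_
  gcongr
  exact (hB _ (hzK s hs)).trans (le_abs_self _)

end Comparison

/-! ### Existence of solutions -/

section Existence

variable {X U : Type*} [NormedAddCommGroup X] [NormedSpace ℝ X] [CompleteSpace X]
  [NormedAddCommGroup U] [NormedSpace ℝ U] [MeasurableSpace U] [BorelSpace U]
  [SecondCountableTopology U]
variable {f₀ : X → X} {g : X → U →L[ℝ] X} {u : ℝ → U}

/-- Existence for globally Lipschitz data.  The unknown is `y(t) = exp(-λ t) z(t)`, for which the
integral operator is a contraction of the space of continuous functions if `λ` is large. -/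
theorem exists_isSolutionOn_of_lipschitz {L₀ L₁ : ℝ} (hL₀ : 0 ≤ L₀) (hL₁ : 0 ≤ L₁)
    (hf : Continuous f₀) (hg : Continuous g)
    (h₀ : ∀ x y, ‖f₀ x - f₀ y‖ ≤ L₀ * ‖x - y‖) (h₁ : ∀ x y, ‖g x - g y‖ ≤ L₁ * ‖x - y‖)
    (hu : AdmissibleInput u) {T : ℝ} (hT : 0 ≤ T) (z₀ : X) :
    ∃ z, IsSolutionOn (affineField f₀ g) u T z ∧ z 0 = z₀ := by
  obtain ⟨c, hc0, hc⟩ := hu.exists_bound T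
  set L : ℝ := L₀ + L₁ * c with hLdef
  have hL : 0 ≤ L := by positivity
  set l : ℝ := 2 * L + 1 with hl
  have hl0 : 0 < l := by positivity
  let F := affineField f₀ g
  have hF : ∀ᵐ s, s ∈ Icc 0 T → ∀ x y, ‖F x (u s) - F y (u s)‖ ≤ L * ‖x - y‖ := by
    filter_upwards [hc] with s hs hsT x y
    have e : F x (u s) - F y (u s) = (f₀ x - f₀ y) + (g x - g y) (u s) := by
      simp only [F, affineField, sub_apply]
      abel
    rw [e, hLdef, add_mul]
    refine (norm_add_le _ _).trans (add_le_add (h₀ _ _) ?_)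
    refine ((g x - g y).le_opNorm _).trans ?_
    refine (mul_le_mul (h₁ _ _) (hs hsT) (norm_nonneg _) (by positivity)).trans_eq ?_
    ring
  let Y : C(Icc 0 T, X) → ℝ → X := fun y t => Real.exp (l * t) • IccExtend hT y t
  have hY : ∀ y, Continuous (Y y) := fun y => by
    have : Continuous (IccExtend hT y) := y.continuous.Icc_extend'
    fun_prop
  have hm0 : (0 : ℝ) ∈ Icc 0 T := ⟨le_rfl, hT⟩
  have hint : ∀ y, ∀ t ∈ Icc 0 T, IntervalIntegrable (fun s => F (Y y s) (u s)) volume 0 t :=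
    fun y t ht => intervalIntegrable_affineField hf hg hu (hY y).continuousOn hm0 ht
  let I : C(Icc 0 T, X) → ℝ → X := fun y t => z₀ + ∫ s in (0 : ℝ)..t, F (Y y s) (u s)
  have hI : ∀ y, ContinuousOn (I y) (Icc 0 T) := fun y => by
    refine continuousOn_const.add ?_
    have := intervalIntegral.continuousOn_primitive_interval' (hint y T ⟨hT, le_rfl⟩) left_mem_uIcc
    rwa [uIcc_of_le hT] at this
  let Φ : C(Icc 0 T, X) → C(Icc 0 T, X) := fun y =>
    ⟨fun t => Real.exp (-(l * t)) • I y t, by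
      have := continuousOn_iff_continuous_domRestrict.1 (hI y)
      have h2 : Continuous fun t : Icc 0 T => I y t := this
      exact (Real.continuous_exp.comp (continuous_const.mul continuous_subtype_val).neg).smul h2⟩
  have hΦ : ContractingWith (1 / 2) Φ := by
    refine ⟨by norm_num [← NNReal.coe_lt_coe], LipschitzWith.of_dist_le_mul fun y y' => ?_⟩
    rw [ContinuousMap.dist_le (by positivity)]
    intro t
    have hD : ∀ s ∈ Icc 0 T, ‖Y y s - Y y' s‖ ≤ Real.exp (l * s) * dist y y' := by
      intro s hs
      simp only [Y, ← smul_sub, norm_smul, Real.norm_eq_abs, Real.abs_exp,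
        IccExtend_of_mem hT _ hs, ← dist_eq_norm]
      gcongr
      exact ContinuousMap.dist_apply_le_dist _
    have e : Φ y t - Φ y' t = Real.exp (-(l * t)) •
        ∫ s in (0 : ℝ)..t, (F (Y y s) (u s) - F (Y y' s) (u s)) := by
      rw [intervalIntegral.integral_sub (hint y t t.2) (hint y' t t.2)]
      simp only [Φ, I, ContinuousMap.coe_mk, ← smul_sub, add_sub_add_left_eq_sub]
    have hprim : ∫ s in (0 : ℝ)..t, L * (Real.exp (l * s) * dist y y') =
        L * dist y y' / l * (Real.exp (l * t) - 1) := by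
      have hd : ∀ s ∈ uIcc 0 (t : ℝ), HasDerivAt (fun s => L * dist y y' / l * Real.exp (l * s))
          (L * (Real.exp (l * s) * dist y y')) s := fun s _ => by
        have := (((hasDerivAt_id s).const_mul l).exp).const_mul (L * dist y y' / l)
        convert! this using 1
        simp only [id]
        field_simp
      rw [intervalIntegral.integral_eq_sub_of_hasDerivAt hd
        (Continuous.intervalIntegrable (by fun_prop) _ _)]
      simp [mul_sub]
    have h1 : ‖∫ s in (0 : ℝ)..t, (F (Y y s) (u s) - F (Y y' s) (u s))‖ ≤
        L * dist y y' / l * (Real.exp (l * t) - 1) := by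
      rw [← hprim]
      refine intervalIntegral.norm_integral_le_of_norm_le t.2.1 ?_
        (Continuous.intervalIntegrable (by fun_prop) _ _)
      filter_upwards [hF] with s hs hst
      have hsT : s ∈ Icc 0 T := ⟨hst.1.le, hst.2.trans t.2.2⟩
      exact (hs hsT _ _).trans (mul_le_mul_of_nonneg_left (hD s hsT) hL)
    rw [dist_eq_norm, e, norm_smul, Real.norm_eq_abs, Real.abs_exp]
    calc Real.exp (-(l * t)) * _
        ≤ Real.exp (-(l * t)) * (L * dist y y' / l * (Real.exp (l * t) - 1)) := by gcongr
      _ ≤ Real.exp (-(l * t)) * (L * dist y y' / l * Real.exp (l * t)) := by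
          gcongr
          linarith
      _ = L / l * dist y y' := by
          rw [Real.exp_neg]
          field_simp
      _ ≤ 1 / 2 * dist y y' := by
          refine mul_le_mul_of_nonneg_right ?_ dist_nonneg
          rw [div_le_div_iff₀ hl0 two_pos]
          linarith
      _ = _ := by norm_num
  obtain ⟨y, hy, -⟩ := hΦ.exists_fixedPoint 0 (edist_ne_top _ _)
  have key : ∀ t ∈ Icc 0 T, Y y t = I y t := by
    intro t ht
    have := DFunLike.congr_fun (show Φ y = y from hy) ⟨t, ht⟩
    simp only [Y, IccExtend_of_mem hT _ ht]
    rw [← this]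
    simp only [Φ, ContinuousMap.coe_mk, smul_smul, ← Real.exp_add, add_neg_cancel, Real.exp_zero,
      one_smul]
  have hY0 : Y y 0 = z₀ := by rw [key 0 hm0]; simp [I]
  refine ⟨Y y, ⟨(hY y).continuousOn, fun t ht => ?_⟩, hY0⟩
  rw [hY0]
  exact key t ht

end Existence

section GlobalExistence

variable {X U : Type*} [NormedAddCommGroup X] [NormedSpace ℝ X] [FiniteDimensional ℝ X]
  [NormedAddCommGroup U] [NormedSpace ℝ U] [MeasurableSpace U] [BorelSpace U]
  [SecondCountableTopology U]
variable {f₀ : X → X} {g : X → U →L[ℝ] X} {u : ℝ → U} {V : X → ℝ} {C : ℝ}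

/-- Existence on compact intervals.  The vector field is multiplied by a bump function which
equals one on a large sublevel set of `V`; the dissipation inequality survives this change, so
that the solution of the modified system never leaves the sublevel set. -/
theorem exists_isSolutionOn (hf : ContDiff ℝ 1 f₀) (hg : ContDiff ℝ 1 g) (hV : ContDiff ℝ 1 V)
    (hC : 0 ≤ C) (hVc : ∀ c, IsCompact {x | V x ≤ c})
    (hd : ∀ x v, fderiv ℝ V x (affineField f₀ g x v) ≤ C * ‖v‖ ^ 2)
    (hu : AdmissibleInput u) {T : ℝ} (hT : 0 ≤ T) (z₀ : X) :
    ∃ z, IsSolutionOn (affineField f₀ g) u T z ∧ z 0 = z₀ := by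
  have : CompleteSpace X := FiniteDimensional.complete ℝ X
  have hiu : ∀ {a b : ℝ}, 0 ≤ a → 0 ≤ b → IntervalIntegrable (fun s => C * ‖u s‖ ^ 2) volume a b :=
    fun ha hb => hu.intervalIntegrable_comp_norm (φ := fun r => C * r ^ 2) (by fun_prop) ha hb
  obtain ⟨R, hR⟩ := (hVc (V z₀ + ∫ s in (0 : ℝ)..T, C * ‖u s‖ ^ 2)).isBounded.subset_closedBall 0
  let χ : ContDiffBump (0 : X) := ⟨|R| + 1, |R| + 2, by positivity, by linarith⟩
  have hχ : ContDiff ℝ 1 χ := χ.contDiff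
  let f₁ : X → X := fun x => χ x • f₀ x
  let g₁ : X → U →L[ℝ] X := fun x => χ x • g x
  have hf₁ : ContDiff ℝ 1 f₁ := hχ.smul hf
  have hg₁ : ContDiff ℝ 1 g₁ := hχ.smul hg
  obtain ⟨L₀, h₀⟩ := hf₁.lipschitzWith_of_hasCompactSupport χ.hasCompactSupport.smul_right
    one_ne_zero
  obtain ⟨L₁, h₁⟩ := hg₁.lipschitzWith_of_hasCompactSupport χ.hasCompactSupport.smul_right
    one_ne_zero
  obtain ⟨z, hz, hz0⟩ := exists_isSolutionOn_of_lipschitz L₀.2 L₁.2 hf₁.continuous hg₁.continuous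
    (fun x y => h₀.norm_sub_le x y) (fun x y => h₁.norm_sub_le x y) hu hT z₀
  have he : ∀ x v, affineField f₁ g₁ x v = χ x • affineField f₀ g x v := fun x v => by
    simp [affineField, f₁, g₁]
  have hd₁ : ∀ x v, fderiv ℝ V x (affineField f₁ g₁ x v) ≤ -(0 : X → ℝ) x + C * ‖v‖ ^ 2 := by
    intro x v
    rw [he, map_smul, smul_eq_mul]
    simp only [Pi.zero_apply, neg_zero, zero_add]
    calc χ x * _ ≤ χ x * (C * ‖v‖ ^ 2) := mul_le_mul_of_nonneg_left (hd x v) χ.nonneg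
      _ ≤ 1 * (C * ‖v‖ ^ 2) := by
        gcongr
        exact χ.le_one
      _ = _ := one_mul _
  have hχz : ∀ t ∈ Icc 0 T, χ (z t) = 1 := by
    intro t ht
    refine χ.one_of_mem_closedBall (Metric.closedBall_subset_closedBall ?_ (hR ?_))
    · exact (le_abs_self R).trans (by simp [χ])
    · have := hz.dissipation hf₁.continuous hg₁.continuous hu hV continuous_zero hd₁ le_rfl ht.1 ht.2
      simp only [Pi.zero_apply, intervalIntegral.integral_zero, add_zero, hz0] at this
      refine this.trans ?_
      rw [← intervalIntegral.integral_add_adjacent_intervals (hiu le_rfl ht.1) (hiu ht.1 hT)]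
      linarith [intervalIntegral.integral_nonneg (μ := volume) ht.2 fun s _ =>
        (mul_nonneg hC (sq_nonneg ‖u s‖) : 0 ≤ C * ‖u s‖ ^ 2)]
  refine ⟨z, ⟨hz.1, fun t ht => ?_⟩, hz0⟩
  rw [hz.2 t ht]
  congr 1
  refine intervalIntegral.integral_congr fun s hs => ?_
  rw [uIcc_of_le ht.1] at hs
  simp only [he, hχz s ⟨hs.1, hs.2.trans ht.2⟩, one_smul]

theorem exists_isSolution (hf : ContDiff ℝ 1 f₀) (hg : ContDiff ℝ 1 g) (hV : ContDiff ℝ 1 V)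
    (hC : 0 ≤ C) (hVc : ∀ c, IsCompact {x | V x ≤ c})
    (hd : ∀ x v, fderiv ℝ V x (affineField f₀ g x v) ≤ C * ‖v‖ ^ 2)
    (hu : AdmissibleInput u) (z₀ : X) :
    ∃ z, IsSolution (affineField f₀ g) u z ∧ z 0 = z₀ := by
  have hN : ∀ N : ℕ, ∃ z, IsSolutionOn (affineField f₀ g) u N z ∧ z 0 = z₀ := fun N =>
    exists_isSolutionOn hf hg hV hC hVc hd hu N.cast_nonneg z₀
  choose ζ hζ hζ0 using hN
  -- by uniqueness the solutions on `[0, N]` fit together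
  have hglue : ∀ N : ℕ, EqOn (fun t => ζ ⌈t⌉₊ t) (ζ N) (Icc 0 N) := by
    intro N t ht
    have hle : (⌈t⌉₊ : ℝ) ≤ N := by exact_mod_cast Nat.ceil_le.2 ht.2
    exact (hζ ⌈t⌉₊).eqOn ((hζ N).mono hle) hf hg hu (by rw [hζ0, hζ0]) ⟨ht.1, Nat.le_ceil t⟩
  refine ⟨fun t => ζ ⌈t⌉₊ t, isSolution_iff_forall_isSolutionOn.2 fun T => ?_, by simp [hζ0]⟩
  have hT : T ≤ (⌈T⌉₊ : ℝ) := Nat.le_ceil T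
  refine IsSolutionOn.mono ⟨(hζ ⌈T⌉₊).1.congr (hglue _), fun t ht => ?_⟩ hT
  have h0 : (0 : ℝ) ∈ Icc (0 : ℝ) ⌈T⌉₊ := ⟨le_rfl, ht.1.trans ht.2⟩
  have e1 := hglue _ ht
  have e0 := hglue _ h0
  simp only at e1 e0 ⊢
  rw [e1, e0, (hζ ⌈T⌉₊).2 t ht]
  congr 1
  refine intervalIntegral.integral_congr fun s hs => ?_
  rw [uIcc_of_le ht.1] at hs
  have es := hglue ⌈T⌉₊ ⟨hs.1, hs.2.trans ht.2⟩
  simp only at es ⊢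
  rw [es]

end GlobalExistence

/-! ### Dissipative systems with a detectable dissipation rate -/

/-- The gain `γ(r) = C r² + r`.  The quadratic term pays for the increase of the storage function,
the linear one for the distance to undisturbed solutions. -/
def iissGain (C r : ℝ) : ℝ := C * r ^ 2 + r

theorem continuous_iissGain (C : ℝ) : Continuous (iissGain C) := by
  unfold iissGain
  fun_prop

theorem integral_iissGain_mono {U : Type*} [NormedAddCommGroup U]
    [MeasurableSpace U] [BorelSpace U] {C : ℝ} (hC : 0 ≤ C) {u : ℝ → U}
    (hu : AdmissibleInput u) {a b c d : ℝ} (ha : 0 ≤ a) (hac : a ≤ c) (hcd : c ≤ d) (hdb : d ≤ b) :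
    ∫ s in c..d, iissGain C ‖u s‖ ≤ ∫ s in a..b, iissGain C ‖u s‖ := by
  refine intervalIntegral.integral_mono_interval hac hcd hdb (Eventually.of_forall fun s => ?_)
    (hu.intervalIntegrable_comp_norm (continuous_iissGain C) ha
      (ha.trans (hac.trans (hcd.trans hdb))))
  exact add_nonneg (mul_nonneg hC (sq_nonneg _)) (norm_nonneg _)

section Dissipative

variable {X U : Type*} [NormedAddCommGroup X] [NormedSpace ℝ X]
  [NormedAddCommGroup U] [NormedSpace ℝ U]

/-- `V` is a nonnegative `C¹` storage function with compact sublevel sets for the `C¹` system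
`ẋ = f₀(x) + g(x) v`: along the vector field its derivative is at most `-ρ(x) + C ‖v‖²`, where the
dissipation rate `ρ` is continuous and nonnegative. -/
structure IsProperStorage (f₀ : X → X) (g : X → U →L[ℝ] X) (V ρ : X → ℝ) (C : ℝ) : Prop where
  contDiff_drift : ContDiff ℝ 1 f₀
  contDiff_input : ContDiff ℝ 1 g
  contDiff_storage : ContDiff ℝ 1 V
  continuous_rate : Continuous ρ
  storage_nonneg : ∀ x, 0 ≤ V x
  rate_nonneg : ∀ x, 0 ≤ ρ x
  const_nonneg : 0 ≤ C
  isCompact_sublevel : ∀ c, IsCompact {x | V x ≤ c}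
  dissipation : ∀ x v, fderiv ℝ V x (affineField f₀ g x v) ≤ -ρ x + C * ‖v‖ ^ 2

/-- Every undisturbed solution along which the rate `ρ` vanishes converges to `ze`. -/
def IsRateDetectable (f₀ : X → X) (g : X → U →L[ℝ] X) (ρ : X → ℝ) (ze : X) : Prop :=
  ∀ z : ℝ → X, IsSolution (affineField f₀ g) (fun _ => 0) z → (∀ t, 0 ≤ t → ρ (z t) = 0) →
    Tendsto z atTop (𝓝 ze)

variable [FiniteDimensional ℝ X] [MeasurableSpace U] [BorelSpace U] [SecondCountableTopology U]
variable {f₀ : X → X} {g : X → U →L[ℝ] X} {V ρ : X → ℝ} {C : ℝ} {ze : X}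

theorem IsProperStorage.exists_isSolution (h : IsProperStorage f₀ g V ρ C) {u : ℝ → U}
    (hu : AdmissibleInput u) (z₀ : X) :
    ∃ z, IsSolution (affineField f₀ g) u z ∧ z 0 = z₀ :=
  _root_.exists_isSolution h.contDiff_drift h.contDiff_input h.contDiff_storage h.const_nonneg
    h.isCompact_sublevel (fun x v => (h.dissipation x v).trans (by linarith [h.rate_nonneg x]))
    hu z₀

theorem IsProperStorage.add_integral_rate_le (h : IsProperStorage f₀ g V ρ C) {u : ℝ → U}
    (hu : AdmissibleInput u) {z : ℝ → X} (hz : IsSolution (affineField f₀ g) u z) {a b : ℝ}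
    (ha : 0 ≤ a) (hab : a ≤ b) :
    V (z b) + ∫ s in a..b, ρ (z s) ≤ V (z a) + ∫ s in a..b, C * ‖u s‖ ^ 2 :=
  have : CompleteSpace X := FiniteDimensional.complete ℝ X
  (hz.isSolutionOn b).dissipation h.contDiff_drift.continuous h.contDiff_input.continuous hu
    h.contDiff_storage h.continuous_rate h.dissipation ha hab le_rfl

theorem IsProperStorage.le_add_integral (h : IsProperStorage f₀ g V ρ C) {u : ℝ → U}
    (hu : AdmissibleInput u) {z : ℝ → X} (hz : IsSolution (affineField f₀ g) u z) {a b : ℝ}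
    (ha : 0 ≤ a) (hab : a ≤ b) :
    V (z b) ≤ V (z a) + ∫ s in a..b, iissGain C ‖u s‖ := by
  have h1 := h.add_integral_rate_le hu hz ha hab
  have h2 := intervalIntegral.integral_nonneg (μ := volume) hab fun s _ => h.rate_nonneg (z s)
  have h3 : ∫ s in a..b, C * ‖u s‖ ^ 2 ≤ ∫ s in a..b, iissGain C ‖u s‖ :=
    intervalIntegral.integral_mono_on hab
      (hu.intervalIntegrable_comp_norm (φ := fun r => C * r ^ 2) (by fun_prop) ha (ha.trans hab))
      (hu.intervalIntegrable_comp_norm (continuous_iissGain C) ha (ha.trans hab))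
      fun s _ => le_add_of_nonneg_right (norm_nonneg _)
  linarith

theorem IsProperStorage.antitone_of_zero_input (h : IsProperStorage f₀ g V ρ C) {z : ℝ → X}
    (hz : IsSolution (affineField f₀ g) (fun _ => (0 : U)) z) {a b : ℝ} (ha : 0 ≤ a)
    (hab : a ≤ b) : V (z b) ≤ V (z a) := by
  simpa [iissGain] using h.le_add_integral admissibleInput_zero hz ha hab

/-- LaSalle's invariance argument: `V` is constant on the solution through a limit point, so the
rate vanishes there, and detectability makes that constant zero. -/
theorem IsProperStorage.exists_storage_lt (h : IsProperStorage f₀ g V ρ C) (hze : V ze = 0)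
    (hdet : IsRateDetectable f₀ g ρ ze) {z : ℝ → X}
    (hz : IsSolution (affineField f₀ g) (fun _ => (0 : U)) z) {ε : ℝ} (hε : 0 < ε) :
    ∃ t, 0 ≤ t ∧ V (z t) < ε := by
  have hanti : Antitone fun k : ℕ => V (z k) := fun i j hij =>
    h.antitone_of_zero_input hz i.cast_nonneg (by exact_mod_cast hij)
  have hlim : ∃ c, Tendsto (fun k : ℕ => V (z k)) atTop (𝓝 c) :=
    ⟨_, tendsto_atTop_ciInf hanti ⟨0, by rintro _ ⟨k, rfl⟩; exact h.storage_nonneg _⟩⟩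
  obtain ⟨c, hc⟩ := hlim
  have hmem : ∀ t, 0 ≤ t → z t ∈ {x | V x ≤ V (z 0)} := fun t ht =>
    h.antitone_of_zero_input hz le_rfl ht
  obtain ⟨w, hw, ψ, hψ, hψw⟩ := (h.isCompact_sublevel (V (z 0))).tendsto_subseq
    fun k : ℕ => hmem k k.cast_nonneg
  obtain ⟨φ, hφ, hφ0⟩ := h.exists_isSolution (u := fun _ => (0 : U)) admissibleInput_zero w
  have hφmem : ∀ t, 0 ≤ t → φ t ∈ {x | V x ≤ V (z 0)} := fun t ht =>
    (h.antitone_of_zero_input hφ le_rfl ht).trans (by rw [hφ0]; exact hw)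
  obtain ⟨L, B, hL, hB, hLB⟩ := exists_norm_sub_le_of_mem_compact h.contDiff_drift
    h.contDiff_input (h.isCompact_sublevel (V (z 0)))
  have hshift : ∀ t, 0 ≤ t → Tendsto (fun j => z (t + ψ j)) atTop (𝓝 (φ t)) := by
    intro t ht
    rw [tendsto_iff_norm_sub_tendsto_zero]
    have hb : ∀ j, ‖z (t + ψ j) - φ t‖ ≤ ‖z (ψ j) - w‖ * Real.exp (L * t) := by
      intro j
      have hs := hz.shift h.contDiff_drift.continuous h.contDiff_input.continuous
        admissibleInput_zero (a := ψ j) (ψ j).cast_nonneg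
      have := hLB t (fun _ => 0) _ φ admissibleInput_zero (hs.isSolutionOn t) (hφ.isSolutionOn t)
        (fun s hs => hmem _ (add_nonneg hs.1 (ψ j).cast_nonneg)) (fun s hs => hφmem s hs.1) t
        ⟨ht, le_rfl⟩
      simpa [hφ0] using this
    refine squeeze_zero (fun _ => norm_nonneg _) hb ?_
    simpa using (tendsto_iff_norm_sub_tendsto_zero.1 hψw).mul_const (Real.exp (L * t))
  have hψt : Tendsto ψ atTop atTop := hψ.tendsto_atTop
  have hconst : ∀ t, 0 ≤ t → V (φ t) = c := by
    intro t ht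
    refine tendsto_nhds_unique ((h.contDiff_storage.continuous.tendsto _).comp (hshift t ht)) ?_
    have hup : Tendsto (fun j => V (z (ψ j : ℕ))) atTop (𝓝 c) := hc.comp hψt
    have hlo : Tendsto (fun j => V (z ((ψ j + ⌈t⌉₊ : ℕ) : ℝ))) atTop (𝓝 c) :=
      hc.comp (tendsto_atTop_mono (fun j => Nat.le_add_right _ _) hψt)
    refine tendsto_of_tendsto_of_tendsto_of_le_of_le hlo hup (fun j => ?_) fun j => ?_
    · refine h.antitone_of_zero_input hz (by positivity) ?_
      push_cast
      linarith [Nat.le_ceil t]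
    · exact h.antitone_of_zero_input hz (by positivity) (by linarith)
  have hrate : ∀ t, 0 ≤ t → ρ (φ t) = 0 := by
    intro t ht
    by_contra hne
    have hpos : 0 < ρ (φ t) := lt_of_le_of_ne (h.rate_nonneg _) (Ne.symm hne)
    have h1 : 0 < ∫ s in (0 : ℝ)..(t + 1), ρ (φ s) :=
      intervalIntegral.integral_pos (by linarith)
        (h.continuous_rate.comp_continuousOn (hφ.1.mono Icc_subset_Ici_self))
        (fun s _ => h.rate_nonneg _) ⟨t, ⟨ht, by linarith⟩, hpos⟩
    have h2 := h.add_integral_rate_le admissibleInput_zero hφ le_rfl (by linarith : 0 ≤ t + 1)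
    rw [hconst _ le_rfl, hconst _ (by linarith)] at h2
    simp at h2
    linarith
  have hc0 : c = 0 := by
    have h1 : Tendsto (fun t => V (φ t)) atTop (𝓝 (V ze)) :=
      (h.contDiff_storage.continuous.tendsto _).comp (hdet φ hφ hrate)
    rw [hze] at h1
    refine tendsto_nhds_unique (tendsto_const_nhds.congr' ?_) h1
    filter_upwards [eventually_ge_atTop 0] with t ht using (hconst t ht).symm
  obtain ⟨k, hk⟩ := (hc.eventually_lt_const (hc0 ▸ hε)).exists
  exact ⟨k, k.cast_nonneg, hk⟩

/-- Uniform attractivity which is robust under inputs of small `L¹` norm. -/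
theorem IsProperStorage.exists_uniform_window (h : IsProperStorage f₀ g V ρ C) (hze : V ze = 0)
    (hdet : IsRateDetectable f₀ g ρ ze) (c : ℝ) {ε : ℝ} (hε : 0 < ε) :
    ∃ T δ : ℝ, 0 < T ∧ 0 < δ ∧ ∀ (u : ℝ → U) (z : ℝ → X), AdmissibleInput u →
      IsSolution (affineField f₀ g) u z → (∀ t ∈ Icc 0 T, V (z t) ≤ c) →
      ∫ s in (0 : ℝ)..T, ‖u s‖ ≤ δ → ∃ t ∈ Icc 0 T, V (z t) < ε := by
  let K : Set X := {x | V x ≤ c}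
  have hK : IsCompact K := h.isCompact_sublevel c
  obtain ⟨L, B, hL, hB, hLB⟩ := exists_norm_sub_le_of_mem_compact h.contDiff_drift
    h.contDiff_input hK
  let p : Set X → Prop := fun S => ∃ T δ : ℝ, 0 < T ∧ 0 < δ ∧ ∀ (u : ℝ → U) (z : ℝ → X),
    AdmissibleInput u → IsSolution (affineField f₀ g) u z → z 0 ∈ S →
      (∀ t ∈ Icc 0 T, V (z t) ≤ c) → ∫ s in (0 : ℝ)..T, ‖u s‖ ≤ δ → ∃ t ∈ Icc 0 T, V (z t) < ε
  have hint : ∀ {u : ℝ → U}, AdmissibleInput u → ∀ {T T' : ℝ}, 0 ≤ T → T ≤ T' →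
      ∫ s in (0 : ℝ)..T, ‖u s‖ ≤ ∫ s in (0 : ℝ)..T', ‖u s‖ := fun hu T T' hT hTT' =>
    intervalIntegral.integral_mono_interval le_rfl hT hTT'
      (Eventually.of_forall fun s => norm_nonneg _)
      (hu.intervalIntegrable_comp_norm continuous_id le_rfl (hT.trans hTT'))
  have hp : p K := by
    refine hK.induction_on (p := p) ⟨1, 1, one_pos, one_pos, fun u z _ _ h0 => h0.elim⟩ ?_ ?_ ?_
    · rintro S S' hSS' ⟨T, δ, hT, hδ, H⟩
      exact ⟨T, δ, hT, hδ, fun u z hu hz h0 => H u z hu hz (hSS' h0)⟩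
    · rintro S S' ⟨T, δ, hT, hδ, H⟩ ⟨T', δ', hT', hδ', H'⟩
      refine ⟨max T T', min δ δ', lt_max_of_lt_left hT, lt_min hδ hδ', ?_⟩
      rintro u z hu hz (h0 | h0) hV hi
      · obtain ⟨t, ht, htε⟩ := H u z hu hz h0
          (fun t ht => hV t ⟨ht.1, ht.2.trans (le_max_left _ _)⟩)
          ((hint hu hT.le (le_max_left _ _)).trans (hi.trans (min_le_left _ _)))
        exact ⟨t, ⟨ht.1, ht.2.trans (le_max_left _ _)⟩, htε⟩
      · obtain ⟨t, ht, htε⟩ := H' u z hu hz h0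
          (fun t ht => hV t ⟨ht.1, ht.2.trans (le_max_right _ _)⟩)
          ((hint hu hT'.le (le_max_right _ _)).trans (hi.trans (min_le_right _ _)))
        exact ⟨t, ⟨ht.1, ht.2.trans (le_max_right _ _)⟩, htε⟩
    · intro w hw
      obtain ⟨φ, hφ, hφ0⟩ := h.exists_isSolution (u := fun _ => (0 : U)) admissibleInput_zero w
      obtain ⟨τ, hτ, hτε⟩ := h.exists_storage_lt hze hdet hφ hε
      obtain ⟨η, hη, hηV⟩ := Metric.eventually_nhds_iff.1
        ((h.contDiff_storage.continuous.tendsto (φ τ)).eventually_lt_const hτε)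
      have hE : 0 < 2 * (1 + B) * Real.exp (L * τ) := by positivity
      let δ := η / (2 * (1 + B) * Real.exp (L * τ))
      have hδ : 0 < δ := div_pos hη hE
      refine ⟨Metric.ball w δ, mem_nhdsWithin_of_mem_nhds (Metric.ball_mem_nhds w hδ),
        τ + 1, δ, by linarith, hδ, fun u z hu hz h0 hV hi => ⟨τ, ⟨hτ, by linarith⟩, hηV ?_⟩⟩
      have h1 := hLB τ u z φ hu (hz.isSolutionOn τ) (hφ.isSolutionOn τ)
        (fun t ht => hV t ⟨ht.1, ht.2.trans (by linarith)⟩)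
        (fun t ht => (h.antitone_of_zero_input hφ le_rfl ht.1).trans (by rw [hφ0]; exact hw))
        τ ⟨hτ, le_rfl⟩
      rw [hφ0] at h1
      rw [dist_eq_norm]
      refine h1.trans_lt ?_
      have h2 : ‖z 0 - w‖ ≤ δ := by rw [← dist_eq_norm]; exact (Metric.mem_ball.1 h0).le
      have h3 : ∫ s in (0 : ℝ)..τ, ‖u s‖ ≤ δ := (hint hu hτ (by linarith)).trans hi
      calc _ ≤ (δ + B * δ) * Real.exp (L * τ) := by gcongr
        _ = η / 2 := by
          simp only [δ]
          field_simp
        _ < η := half_lt_self hη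
  obtain ⟨T, δ, hT, hδ, H⟩ := hp
  exact ⟨T, δ, hT, hδ, fun u z hu hz hV => H u z hu hz (hV 0 ⟨le_rfl, hT.le⟩) hV⟩

/-- Uniform decay up to the energy of the input.  If the input has spent less than `c`, then among
sufficiently many consecutive windows there is one in which it is small, and there the storage
function drops below `ε`; if it has spent more, the claim is trivial. -/
theorem IsProperStorage.exists_time_half_storage_le (h : IsProperStorage f₀ g V ρ C)
    (hze : V ze = 0) (hdet : IsRateDetectable f₀ g ρ ze) (c : ℝ) {ε : ℝ} (hε : 0 < ε) :
    ∃ T', 0 ≤ T' ∧ ∀ (u : ℝ → U) (z : ℝ → X), AdmissibleInput u →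
      IsSolution (affineField f₀ g) u z → V (z 0) ≤ c → ∀ t, T' ≤ t →
      V (z t) / 2 ≤ ε + ∫ s in (0 : ℝ)..t, iissGain C ‖u s‖ := by
  obtain ⟨T, δ, hT, hδ, H⟩ := h.exists_uniform_window hze hdet (2 * c) hε
  obtain ⟨N, hN⟩ := exists_nat_gt (c / δ)
  refine ⟨N * T, by positivity, fun u z hu hz h0 t ht => ?_⟩
  have hNT : (0 : ℝ) ≤ N * T := by positivity
  have ht0 : 0 ≤ t := hNT.trans ht
  set J := ∫ s in (0 : ℝ)..t, iissGain C ‖u s‖ with hJ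
  have hle := h.le_add_integral hu hz le_rfl ht0
  rw [← hJ] at hle
  rcases le_or_gt c J with hcJ | hcJ
  · linarith
  have hVt : ∀ s ∈ Icc 0 t, V (z s) ≤ 2 * c := by
    intro s hs
    have h1 := h.le_add_integral hu hz le_rfl hs.1
    have h2 := integral_iissGain_mono h.const_nonneg hu le_rfl le_rfl hs.1 hs.2
    linarith
  have hiu : ∀ {a b : ℝ}, 0 ≤ a → 0 ≤ b → IntervalIntegrable (fun s => ‖u s‖) volume a b :=
    fun ha hb => hu.intervalIntegrable_comp_norm continuous_id ha hb
  have hwin : ∃ k < N, ∫ s in ((k : ℕ) : ℝ) * T..((k + 1 : ℕ) : ℝ) * T, ‖u s‖ ≤ δ := by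
    by_contra! hcon
    have hsum : ∑ k ∈ Finset.range N, ∫ s in ((k : ℕ) : ℝ) * T..((k + 1 : ℕ) : ℝ) * T, ‖u s‖ =
        ∫ s in ((0 : ℕ) : ℝ) * T..(N : ℝ) * T, ‖u s‖ :=
      intervalIntegral.sum_integral_adjacent_intervals (a := fun k : ℕ => (k : ℝ) * T)
        fun k _ => hiu (by positivity) (by positivity)
    have h1 : N * δ ≤ ∑ k ∈ Finset.range N,
        ∫ s in ((k : ℕ) : ℝ) * T..((k + 1 : ℕ) : ℝ) * T, ‖u s‖ := by
      have := Finset.card_nsmul_le_sum (Finset.range N)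
        (fun k : ℕ => ∫ s in ((k : ℕ) : ℝ) * T..((k + 1 : ℕ) : ℝ) * T, ‖u s‖) δ
        fun k hk => (hcon k (Finset.mem_range.1 hk)).le
      simpa using this
    have h2 : ∫ s in (0 : ℝ)..(N : ℝ) * T, ‖u s‖ ≤
        ∫ s in (0 : ℝ)..(N : ℝ) * T, iissGain C ‖u s‖ :=
      intervalIntegral.integral_mono_on hNT (hiu le_rfl hNT)
        (hu.intervalIntegrable_comp_norm (continuous_iissGain C) le_rfl hNT)
        fun s _ => le_add_of_nonneg_left (mul_nonneg h.const_nonneg (sq_nonneg _))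
    have h3 := integral_iissGain_mono h.const_nonneg hu le_rfl le_rfl hNT ht
    have h4 : c < N * δ := (div_lt_iff₀ hδ).1 hN
    simp only [Nat.cast_zero, zero_mul] at hsum
    linarith
  obtain ⟨k, hkN, hk⟩ := hwin
  have hk0 : (0 : ℝ) ≤ k * T := by positivity
  have hkt : (k : ℝ) * T + T ≤ t := by
    have : ((k + 1 : ℕ) : ℝ) ≤ N := by exact_mod_cast hkN
    push_cast at this
    nlinarith
  obtain ⟨s, hs, hsε⟩ := H (fun t => u (t + k * T)) (fun t => z (t + k * T)) (hu.shift hk0)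
    (hz.shift h.contDiff_drift.continuous h.contDiff_input.continuous hu hk0)
    (fun s hs => hVt _ ⟨add_nonneg hs.1 hk0, by linarith [hs.2]⟩) (by
      rw [intervalIntegral.integral_comp_add_right (fun s => ‖u s‖)]
      push_cast at hk
      convert hk using 2 <;> ring)
  have h1 := h.le_add_integral hu hz (add_nonneg hs.1 hk0) (by linarith [hs.2] : s + k * T ≤ t)
  have h2 := integral_iissGain_mono h.const_nonneg hu le_rfl (add_nonneg hs.1 hk0)
    (by linarith [hs.2] : s + k * T ≤ t) le_rfl
  have h3 := h.storage_nonneg (z t)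
  linarith

end Dissipative

/-! ### Comparison functions -/

/-- A function which is proper and vanishes only where `σ` does dominates a class `𝒦∞` function
of `σ`.  The infimal convolution of `W` with the distance in the values of `σ` is `1`-Lipschitz,
monotone, positive off zero and unbounded; the factor `r / (1 + r)` makes it strictly increasing. -/
theorem exists_classKInf_comp_le {X : Type*} [TopologicalSpace X] {W σ : X → ℝ}
    (hW : Continuous W) (hσ : Continuous σ) (hW0 : ∀ x, 0 ≤ W x) (hσ0 : ∀ x, 0 ≤ σ x)
    (hWc : ∀ c, IsCompact {x | W x ≤ c}) (hWσ : ∀ x, W x = 0 → σ x = 0)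
    {x₀ : X} (hx₀ : W x₀ = 0) :
    ∃ α, ClassKInf α ∧ ∀ x, α (σ x) ≤ W x := by
  have : Nonempty X := ⟨x₀⟩
  let k : ℝ → X → ℝ := fun r x => W x + max 0 (r - σ x)
  have hk0 : ∀ r x, 0 ≤ k r x := fun r x => add_nonneg (hW0 x) (le_max_left _ _)
  have hbdd : ∀ r, BddBelow (range (k r)) := fun r => ⟨0, by rintro _ ⟨x, rfl⟩; exact hk0 r x⟩
  let a : ℝ → ℝ := fun r => ⨅ x, k r x
  have ha_le : ∀ r x, a r ≤ k r x := fun r x => ciInf_le (hbdd r) x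
  have ha0 : ∀ r, 0 ≤ a r := fun r => le_ciInf (hk0 r)
  have hmono : Monotone a := fun r r' hrr' => le_ciInf fun x => (ha_le r x).trans <|
    add_le_add_right (max_le_max le_rfl (by linarith)) _
  have hcont : Continuous a := by
    refine (LipschitzWith.of_le_add (f := a) fun r r' => ?_).continuous
    rw [← sub_le_iff_le_add]
    refine le_ciInf fun x => ?_
    rw [sub_le_iff_le_add]
    refine (ha_le r x).trans ?_
    have h1 : r - r' ≤ dist r r' := le_abs_self _
    have h2 : max 0 (r - σ x) ≤ max 0 (r' - σ x) + dist r r' := by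
      refine max_le (add_nonneg (le_max_left _ _) dist_nonneg) ?_
      linarith [le_max_right 0 (r' - σ x)]
    simp only [k]
    linarith
  have hpos : ∀ r, 0 < r → 0 < a r := by
    intro r hr
    have hkc : Continuous (k r) := hW.add (continuous_const.max (continuous_const.sub hσ))
    obtain ⟨x₁, -, hx₁⟩ := (hWc r).exists_isMinOn ⟨x₀, by simp [hx₀, hr.le]⟩ hkc.continuousOn
    have h1 : 0 < k r x₁ := by
      rcases (hW0 x₁).lt_or_eq with hlt | heq
      · exact add_pos_of_pos_of_nonneg hlt (le_max_left _ _)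
      · simp only [k, ← heq, hWσ x₁ heq.symm, sub_zero, zero_add]
        exact lt_max_of_lt_right hr
    refine (lt_min h1 hr).trans_le (le_ciInf fun x => ?_)
    rcases le_or_gt (W x) r with hx | hx
    · exact (min_le_left _ _).trans (hx₁ hx)
    · exact (min_le_right _ _).trans (hx.le.trans (le_add_of_nonneg_right (le_max_left _ _)))
  have hlim : Tendsto a atTop atTop := by
    refine tendsto_atTop.2 fun c => ?_
    obtain ⟨S, hS⟩ := (hWc c).bddAbove_image hσ.continuousOn
    filter_upwards [eventually_ge_atTop (S + c)] with r hr
    refine le_ciInf fun x => ?_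
    rcases le_or_gt (W x) c with hx | hx
    · have h1 : σ x ≤ S := hS (mem_image_of_mem _ hx)
      have h2 := le_max_right 0 (r - σ x)
      have h3 := hW0 x
      simp only [k]
      linarith
    · exact hx.le.trans (le_add_of_nonneg_right (le_max_left _ _))
  refine ⟨fun r => r / (1 + r) * a r, ⟨⟨?_, ?_, by simp⟩, ?_⟩, fun x => ?_⟩
  · refine ContinuousOn.mul (ContinuousOn.div continuousOn_id (by fun_prop) fun r hr => ?_)
      hcont.continuousOn
    have : (0 : ℝ) ≤ r := hr
    positivity
  · intro r hr r' hr' hrr'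
    have h0 : (0 : ℝ) ≤ r := hr
    have h0' : (0 : ℝ) < r' := h0.trans_lt hrr'
    have h1 : r / (1 + r) < r' / (1 + r') := by
      rw [div_lt_div_iff₀ (by positivity) (by positivity)]
      linarith
    calc r / (1 + r) * a r ≤ r / (1 + r) * a r' := by
          gcongr
          exact hmono hrr'.le
      _ < r' / (1 + r') * a r' := mul_lt_mul_of_pos_right h1 (hpos r' h0')
  · refine tendsto_atTop_mono' _ ?_ (hlim.const_mul_atTop (show (0 : ℝ) < 1 / 2 by norm_num))
    filter_upwards [eventually_ge_atTop 1] with r hr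
    refine mul_le_mul_of_nonneg_right ?_ (ha0 r)
    rw [div_le_div_iff₀ two_pos (by linarith)]
    linarith
  · have h0 := hσ0 x
    have h1 : σ x / (1 + σ x) ≤ 1 := (div_le_one (by positivity)).2 (by linarith)
    have h2 : a (σ x) ≤ W x := (ha_le _ x).trans (by simp [k])
    calc σ x / (1 + σ x) * a (σ x) ≤ 1 * a (σ x) := mul_le_mul_of_nonneg_right h1 (ha0 _)
      _ ≤ W x := by rwa [one_mul]

/-- A bound which is monotone in the size and decays in time is dominated by a class `𝒦ℒ`
function: average it over sizes in `[s, 2 s]`, which gives continuity, and add `s exp(-t)`, which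
gives strict monotonicity. -/
theorem exists_classKL_ge {b : ℝ → ℝ → ℝ} (hb0 : ∀ s t, 0 ≤ t → 0 ≤ b s t)
    (hmono : ∀ t, 0 ≤ t → Monotone fun s => b s t) (hanti : ∀ s, AntitoneOn (b s) (Ici 0))
    (hzero : Tendsto (fun s => b s 0) (𝓝 0) (𝓝 0)) (hlim : ∀ s, Tendsto (b s) atTop (𝓝 0)) :
    ∃ β, ClassKL β ∧ ∀ s t, 0 ≤ s → 0 ≤ t → b s t ≤ β s t := by
  let A : ℝ → ℝ → ℝ := fun s t => ∫ τ in (1 : ℝ)..2, b (s * τ) t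
  have hint : ∀ s t, 0 ≤ s → 0 ≤ t →
      IntervalIntegrable (fun τ => b (s * τ) t) volume 1 2 := fun s t hs ht =>
    Monotone.intervalIntegrable fun τ τ' h => hmono t ht (mul_le_mul_of_nonneg_left h hs)
  have hA0 : ∀ s t, 0 ≤ t → 0 ≤ A s t := fun s t ht =>
    intervalIntegral.integral_nonneg one_le_two fun τ _ => hb0 _ _ ht
  have hAlow : ∀ s t, 0 ≤ s → 0 ≤ t → b s t ≤ A s t := by
    intro s t hs ht
    have := intervalIntegral.integral_mono_on (μ := volume) one_le_two
      (intervalIntegrable_const (c := b s t)) (hint s t hs ht) fun τ hτ =>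
        hmono t ht (le_mul_of_one_le_right hs hτ.1)
    rw [intervalIntegral.integral_const] at this
    norm_num at this
    exact this
  have hAup : ∀ s t, 0 ≤ s → 0 ≤ t → A s t ≤ b (s * 2) t := by
    intro s t hs ht
    have := intervalIntegral.integral_mono_on (μ := volume) one_le_two (hint s t hs ht)
      (intervalIntegrable_const (c := b (s * 2) t)) fun τ hτ =>
        hmono t ht (mul_le_mul_of_nonneg_left hτ.2 hs)
    rw [intervalIntegral.integral_const] at this
    norm_num at this
    exact this
  have hAmono : ∀ t, 0 ≤ t → ∀ s s', 0 ≤ s → s ≤ s' → A s t ≤ A s' t := fun t ht s s' hs hss' =>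
    intervalIntegral.integral_mono_on one_le_two (hint s t hs ht) (hint s' t (hs.trans hss') ht)
      fun τ hτ => hmono t ht (mul_le_mul_of_nonneg_right hss' (zero_le_one.trans hτ.1))
  have hAanti : ∀ s, 0 ≤ s → ∀ t t', 0 ≤ t → t ≤ t' → A s t' ≤ A s t := fun s hs t t' ht htt' =>
    intervalIntegral.integral_mono_on one_le_two (hint s t' hs (ht.trans htt')) (hint s t hs ht)
      fun τ _ => hanti _ ht (ht.trans htt') htt'
  have hAz : ∀ t, 0 ≤ t → A 0 t = 0 := by
    intro t ht
    have h00 : b 0 0 = 0 :=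
      tendsto_nhds_unique (tendsto_pure_nhds _ _) (hzero.mono_left (pure_le_nhds 0))
    refine le_antisymm ((hAup 0 t le_rfl ht).trans ?_) (hA0 0 t ht)
    rw [zero_mul]
    exact (hanti 0 self_mem_Ici ht ht).trans h00.le
  have hAcont : ∀ t, 0 ≤ t → ContinuousOn (fun s => A s t) (Ici 0) := by
    intro t ht s hs
    rcases (show (0 : ℝ) ≤ s from hs).eq_or_lt with rfl | hs0
    · have hlim2 : Tendsto (fun s : ℝ => b (s * 2) 0) (𝓝[Ici 0] 0) (𝓝 0) := by
        refine hzero.comp (tendsto_nhdsWithin_of_tendsto_nhds ?_)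
        have : Continuous fun s : ℝ => s * 2 := by fun_prop
        simpa using this.tendsto 0
      rw [ContinuousWithinAt, hAz t ht]
      refine tendsto_of_tendsto_of_tendsto_of_le_of_le' tendsto_const_nhds hlim2
        (Eventually.of_forall fun s => hA0 s t ht) ?_
      filter_upwards [self_mem_nhdsWithin] with s hs
      exact (hAup s t hs ht).trans (hanti _ self_mem_Ici ht ht)
    · refine ContinuousAt.continuousWithinAt ?_
      let P : ℝ → ℝ := fun x => ∫ σ in (0 : ℝ)..x, b σ t
      have hii : ∀ x y, IntervalIntegrable (fun σ => b σ t) volume x y := fun x y =>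
        (hmono t ht).intervalIntegrable
      have hP : Continuous P := intervalIntegral.continuous_primitive hii 0
      have he : ∀ x, x ≠ 0 → A x t = x⁻¹ * (P (x * 2) - P (x * 1)) := by
        intro x hx
        simp only [A, P]
        rw [intervalIntegral.integral_comp_mul_left (fun σ => b σ t) hx,
          intervalIntegral.integral_interval_sub_left (hii _ _) (hii _ _), smul_eq_mul]
      have hc : ContinuousAt (fun x => x⁻¹ * (P (x * 2) - P (x * 1))) s :=
        (continuousAt_inv₀ hs0.ne').mul (by fun_prop)
      refine hc.congr ?_
      filter_upwards [isOpen_ne.mem_nhds hs0.ne'] with x hx using (he x hx).symm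
  refine ⟨fun s t => A s t + s * Real.exp (-t), ⟨fun t ht => ⟨?_, ?_, ?_⟩, fun s hs => ⟨?_, ?_⟩⟩,
    fun s t hs ht => (hAlow s t hs ht).trans (le_add_of_nonneg_right (by positivity))⟩
  · exact (hAcont t ht).add (by fun_prop)
  · intro s hs s' hs' hss'
    exact add_lt_add_of_le_of_lt (hAmono t ht s s' hs hss'.le)
      (mul_lt_mul_of_pos_right hss' (Real.exp_pos _))
  · simp [hAz t ht]
  · intro t ht t' ht' htt'
    refine add_le_add (hAanti s hs t t' ht htt') (mul_le_mul_of_nonneg_left ?_ hs)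
    exact Real.exp_le_exp.2 (by linarith)
  · have h1 : Tendsto (fun t => A s t) atTop (𝓝 0) := by
      refine tendsto_of_tendsto_of_tendsto_of_le_of_le' tendsto_const_nhds (hlim (s * 2)) ?_ ?_
      · filter_upwards [eventually_ge_atTop 0] with t ht using hA0 s t ht
      · filter_upwards [eventually_ge_atTop 0] with t ht using hAup s t hs ht
    have h2 : Tendsto (fun t => s * Real.exp (-t)) atTop (𝓝 0) := by
      simpa using (Real.tendsto_exp_neg_atTop_nhds_zero).const_mul s
    simpa using h1.add h2

theorem classKInf_iissGain {C : ℝ} (hC : 0 ≤ C) : ClassKInf (iissGain C) := by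
  refine ⟨⟨(continuous_iissGain C).continuousOn, ?_, by simp [iissGain]⟩, ?_⟩
  · intro r hr r' _ hrr'
    have h0 : (0 : ℝ) ≤ r := hr
    refine add_lt_add_of_le_of_lt ?_ hrr'
    gcongr
  · exact tendsto_atTop_mono (fun r => le_add_of_nonneg_left (mul_nonneg hC (sq_nonneg r)))
      tendsto_id

/-! ### Integral input-to-state stability of dissipative systems -/

section IISS

variable {X U : Type*} [NormedAddCommGroup X] [NormedSpace ℝ X] [FiniteDimensional ℝ X]
  [NormedAddCommGroup U] [NormedSpace ℝ U] [MeasurableSpace U] [BorelSpace U]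
  [SecondCountableTopology U]
variable {f₀ : X → X} {g : X → U →L[ℝ] X} {V ρ : X → ℝ} {C : ℝ} {ze : X}

/-- The excesses `V(z(τ)) / 2 - ∫₀^τ γ(‖u‖)` over all inputs, all solutions which start within
size `s` of `ze`, and all times `τ ≥ t`; zero is included. -/
def excessSet (f₀ : X → X) (g : X → U →L[ℝ] X) (V : X → ℝ) (C : ℝ) (size : X → ℝ) (ze : X)
    (s t : ℝ) : Set ℝ :=
  insert 0 {e | ∃ (u : ℝ → U) (z : ℝ → X) (τ : ℝ), AdmissibleInput u ∧
    IsSolution (affineField f₀ g) u z ∧ size (z 0 - ze) ≤ s ∧ t ≤ τ ∧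
    e = V (z τ) / 2 - ∫ σ in (0 : ℝ)..τ, iissGain C ‖u σ‖}

theorem IsProperStorage.excess_le (h : IsProperStorage f₀ g V ρ C) {u : ℝ → U}
    (hu : AdmissibleInput u) {z : ℝ → X} (hz : IsSolution (affineField f₀ g) u z) {τ : ℝ}
    (hτ : 0 ≤ τ) : V (z τ) / 2 - ∫ σ in (0 : ℝ)..τ, iissGain C ‖u σ‖ ≤ V (z 0) := by
  have h1 := h.le_add_integral hu hz le_rfl hτ
  have h2 := integral_iissGain_mono h.const_nonneg hu le_rfl le_rfl le_rfl hτ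
  rw [intervalIntegral.integral_same] at h2
  linarith [h.storage_nonneg (z 0)]

/-- A system with a proper storage function that vanishes only at `ze` and a detectable dissipation
rate is integral input-to-state stable. -/
theorem IsProperStorage.isIISS (h : IsProperStorage f₀ g V ρ C) (hze : ∀ x, V x = 0 ↔ x = ze)
    (hdet : IsRateDetectable f₀ g ρ ze) {size : X → ℝ} (hsize : Continuous size)
    (hsize0 : size 0 = 0) (hnorm : ∀ x, ‖x‖ ≤ size x) :
    IsIISS (affineField f₀ g) size ze := by
  have hVze : V ze = 0 := (hze ze).2 rfl
  have hVc := h.contDiff_storage.continuous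
  have hball : ∀ s, ∃ c, ∀ x, size (x - ze) ≤ s → V x ≤ c := by
    intro s
    obtain ⟨c, hc⟩ := (isCompact_closedBall ze s).bddAbove_image hVc.continuousOn
    refine ⟨c, fun x hx => hc (mem_image_of_mem _ ?_)⟩
    rw [Metric.mem_closedBall, dist_eq_norm]
    exact (hnorm _).trans hx
  let E := excessSet f₀ g V C size ze
  let b : ℝ → ℝ → ℝ := fun s t => sSup (E s t)
  have hE0 : ∀ s t, (0 : ℝ) ∈ E s t := fun s t => mem_insert _ _
  have hbdd : ∀ s t, 0 ≤ t → BddAbove (E s t) := by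
    intro s t ht
    obtain ⟨c, hc⟩ := hball s
    refine ⟨max 0 c, ?_⟩
    rintro e (rfl | ⟨u, z, τ, hu, hz, hs, hτ, rfl⟩)
    · exact le_max_left _ _
    · exact ((h.excess_le hu hz (ht.trans hτ)).trans (hc _ hs)).trans (le_max_right _ _)
  have hb0 : ∀ s t, 0 ≤ t → 0 ≤ b s t := fun s t ht => le_csSup (hbdd s t ht) (hE0 s t)
  have hb_le : ∀ s t c, 0 ≤ c → (∀ (u : ℝ → U) (z : ℝ → X) (τ : ℝ), AdmissibleInput u →
      IsSolution (affineField f₀ g) u z → size (z 0 - ze) ≤ s → t ≤ τ →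
      V (z τ) / 2 - ∫ σ in (0 : ℝ)..τ, iissGain C ‖u σ‖ ≤ c) → b s t ≤ c := by
    intro s t c hc H
    refine csSup_le ⟨0, hE0 s t⟩ ?_
    rintro e (rfl | ⟨u, z, τ, hu, hz, hs, hτ, rfl⟩)
    exacts [hc, H u z τ hu hz hs hτ]
  have hmono : ∀ t, 0 ≤ t → Monotone fun s => b s t := fun t ht s s' hss' =>
    csSup_le_csSup (hbdd s' t ht) ⟨0, hE0 s t⟩ <| insert_subset_insert <| by
      rintro e ⟨u, z, τ, hu, hz, hs, hτ, rfl⟩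
      exact ⟨u, z, τ, hu, hz, hs.trans hss', hτ, rfl⟩
  have hanti : ∀ s, AntitoneOn (b s) (Ici 0) := fun s t ht t' _ htt' =>
    csSup_le_csSup (hbdd s t ht) ⟨0, hE0 s t'⟩ <| insert_subset_insert <| by
      rintro e ⟨u, z, τ, hu, hz, hs, hτ, rfl⟩
      exact ⟨u, z, τ, hu, hz, hs, htt'.trans hτ, rfl⟩
  have hzero : Tendsto (fun s => b s 0) (𝓝 0) (𝓝 0) := by
    refine Metric.tendsto_nhds_nhds.2 fun ε hε => ?_
    obtain ⟨δ, hδ, H⟩ := Metric.eventually_nhds_iff.1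
      ((hVc.tendsto ze).eventually_lt_const (show V ze < ε / 2 by rw [hVze]; positivity))
    refine ⟨δ, hδ, fun s hs => ?_⟩
    rw [Real.dist_eq, sub_zero, abs_of_nonneg (hb0 s 0 le_rfl)]
    refine lt_of_le_of_lt (hb_le s 0 (ε / 2) (by positivity) fun u z τ hu hz hzs hτ => ?_)
      (half_lt_self hε)
    refine (h.excess_le hu hz hτ).trans (H ?_).le
    rw [dist_eq_norm]
    rw [Real.dist_eq, sub_zero] at hs
    exact ((hnorm _).trans hzs).trans_lt ((le_abs_self s).trans_lt hs)
  have hlim : ∀ s, Tendsto (b s) atTop (𝓝 0) := by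
    intro s
    obtain ⟨c, hc⟩ := hball s
    refine Metric.tendsto_atTop.2 fun ε hε => ?_
    obtain ⟨T, hT, H⟩ := h.exists_time_half_storage_le hVze hdet c (half_pos hε)
    refine ⟨T, fun t ht => ?_⟩
    rw [Real.dist_eq, sub_zero, abs_of_nonneg (hb0 s t (hT.trans ht))]
    refine lt_of_le_of_lt (hb_le s t (ε / 2) (by positivity) fun u z τ hu hz hzs hτ => ?_)
      (half_lt_self hε)
    have := H u z hu hz (hc _ hzs) τ (ht.trans hτ)
    linarith
  obtain ⟨β, hβ, hbβ⟩ := exists_classKL_ge hb0 hmono hanti hzero hlim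
  have hsnn : ∀ x, 0 ≤ size x := fun x => (norm_nonneg x).trans (hnorm x)
  obtain ⟨α, hα, hαV⟩ := exists_classKInf_comp_le (W := fun x => V x / 2)
    (σ := fun x => size (x - ze)) (by fun_prop) (by fun_prop)
    (fun x => by linarith [h.storage_nonneg x]) (fun x => hsnn _)
    (fun c => by
      have e : {x | V x / 2 ≤ c} = {x | V x ≤ c * 2} := by
        ext x
        exact div_le_iff₀ (two_pos (α := ℝ))
      rw [e]
      exact h.isCompact_sublevel _)
    (fun x hx => by
      have : V x = 0 := by simpa using hx
      rw [(hze x).1 this, sub_self, hsize0])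
    (x₀ := ze) (by simp [hVze])
  refine ⟨α, β, iissGain C, hα, hβ, classKInf_iissGain h.const_nonneg, fun u hu z₀ =>
    ⟨h.exists_isSolution hu z₀, ?_⟩⟩
  rintro z hz rfl t ht
  have h1 : V (z t) / 2 - ∫ σ in (0 : ℝ)..t, iissGain C ‖u σ‖ ≤ b (size (z 0 - ze)) t :=
    le_csSup (hbdd _ t ht) (mem_insert_of_mem _ ⟨u, z, t, hu, hz, le_rfl, le_rfl, rfl⟩)
  have h2 := hbβ (size (z 0 - ze)) t (hsnn _) ht
  have h3 := hαV (z t)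
  linarith

end IISS

/-! ### Matrix fields -/

theorem inner_eq_dotProduct {k : ℕ} (x y : Vec k) : inner ℝ x y = x.ofLp ⬝ᵥ y.ofLp := by
  rw [EuclideanSpace.inner_eq_star_dotProduct, dotProduct_comm]
  rfl

theorem inner_mulE_right {a b : ℕ} (A : Matrix (Fin a) (Fin b) ℝ) (x : Vec a) (y : Vec b) :
    inner ℝ x (mulE A y) = inner ℝ (mulE Aᵀ x) y := by
  simp only [inner_eq_dotProduct, mulE, Matrix.mulVec_transpose, Matrix.dotProduct_mulVec]

theorem mulE_mul {a b c : ℕ} (A : Matrix (Fin a) (Fin b) ℝ) (B : Matrix (Fin b) (Fin c) ℝ)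
    (x : Vec c) : mulE (A * B) x = mulE A (mulE B x) := by
  simp [mulE, Matrix.mulVec_mulVec]

theorem dotProduct_mulVec_self_of_skew {ι : Type*} [Fintype ι] {J : Matrix ι ι ℝ} (hJ : Jᵀ = -J)
    (v : ι → ℝ) : v ⬝ᵥ J *ᵥ v = 0 := by
  have h1 : v ⬝ᵥ J *ᵥ v = v ⬝ᵥ Jᵀ *ᵥ v := by
    rw [Matrix.mulVec_transpose, Matrix.dotProduct_mulVec, dotProduct_comm]
  rw [hJ, Matrix.neg_mulVec, dotProduct_neg] at h1
  linarith

/-- `x ↦ A x` as a continuous linear map of Euclidean spaces. -/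
noncomputable def mulCLM {a b : ℕ} (A : Matrix (Fin a) (Fin b) ℝ) : Vec b →L[ℝ] Vec a :=
  LinearMap.toContinuousLinearMap
    { toFun := mulE A
      map_add' := fun x y => by simp [mulE, Matrix.mulVec_add]
      map_smul' := fun c x => by simp [mulE, Matrix.mulVec_smul] }

theorem mulCLM_apply {a b : ℕ} (A : Matrix (Fin a) (Fin b) ℝ) (x : Vec b) :
    mulCLM A x = mulE A x := rfl

section MatrixFields

variable {E : Type*} [NormedAddCommGroup E] [NormedSpace ℝ E] {k : WithTop ℕ∞}

theorem contDiff_mulE {a b : ℕ} {A : E → Matrix (Fin a) (Fin b) ℝ} {x : E → Vec b}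
    (hA : ∀ i j, ContDiff ℝ k fun e => A e i j) (hx : ContDiff ℝ k x) :
    ContDiff ℝ k fun e => mulE (A e) (x e) := by
  rw [contDiff_euclidean] at hx ⊢
  intro i
  simp only [mulE, Matrix.mulVec, dotProduct]
  exact ContDiff.sum fun j _ => (hA i j).mul (hx j)

theorem contDiff_matrix_mul {a b c : ℕ} {A : E → Matrix (Fin a) (Fin b) ℝ}
    {B : E → Matrix (Fin b) (Fin c) ℝ} (hA : ∀ i j, ContDiff ℝ k fun e => A e i j)
    (hB : ∀ i j, ContDiff ℝ k fun e => B e i j) (i : Fin a) (j : Fin c) :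
    ContDiff ℝ k fun e => (A e * B e) i j := by
  simp only [Matrix.mul_apply]
  exact ContDiff.sum fun l _ => (hA i l).mul (hB l j)

theorem contDiff_matrix_det {a : ℕ} {A : E → Matrix (Fin a) (Fin a) ℝ}
    (hA : ∀ i j, ContDiff ℝ k fun e => A e i j) : ContDiff ℝ k fun e => (A e).det := by
  simp only [Matrix.det_apply']
  exact ContDiff.sum fun σ _ => contDiff_const.mul (contDiff_prod fun i _ => hA _ _)

theorem contDiff_matrix_inv {a : ℕ} {A : E → Matrix (Fin a) (Fin a) ℝ}
    (hA : ∀ i j, ContDiff ℝ k fun e => A e i j) (hdet : ∀ e, (A e).det ≠ 0) (i j : Fin a) :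
    ContDiff ℝ k fun e => (A e)⁻¹ i j := by
  simp only [Matrix.inv_def, Ring.inverse_eq_inv', Matrix.smul_apply, smul_eq_mul,
    Matrix.adjugate_apply]
  refine ((contDiff_matrix_det hA).inv hdet).mul (contDiff_matrix_det fun i' j' => ?_)
  simp only [Matrix.updateRow_apply]
  split_ifs
  exacts [contDiff_const, hA i' j']

end MatrixFields

theorem lambdaMin_nonneg {k : ℕ} {K : Matrix (Fin k) (Fin k) ℝ} (hK : K.PosDef) :
    0 ≤ lambdaMin hK.isHermitian :=
  Real.iInf_nonneg fun i => (hK.eigenvalues_pos i).le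

theorem lambdaMin_pos {k : ℕ} [Nonempty (Fin k)] {K : Matrix (Fin k) (Fin k) ℝ} (hK : K.PosDef) :
    0 < lambdaMin hK.isHermitian := by
  obtain ⟨i, hi⟩ := exists_eq_ciInf_of_finite (f := hK.isHermitian.eigenvalues)
  rw [lambdaMin, ← hi]
  exact hK.eigenvalues_pos i

/-- The smallest eigenvalue bounds the quadratic form from below. -/
theorem lambdaMin_mul_norm_sq_le {k : ℕ} {K : Matrix (Fin k) (Fin k) ℝ} (hK : K.IsHermitian)
    (x : Vec k) : lambdaMin hK * ‖x‖ ^ 2 ≤ inner ℝ x (mulE K x) := by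
  let b := hK.eigenvectorBasis
  have hKt : Kᵀ = K := by simpa using hK.eq
  have h1 : ∀ i, inner ℝ (b i) (mulE K x) = hK.eigenvalues i * inner ℝ (b i) x := by
    intro i
    have : mulE K (b i) = hK.eigenvalues i • b i := by
      have := hK.mulVec_eigenvectorBasis i
      rw [mulE]
      exact congrArg (WithLp.toLp 2) this
    rw [inner_mulE_right, hKt, this, real_inner_smul_left]
  rw [← b.sum_inner_mul_inner x (mulE K x), ← b.sum_sq_norm_inner_right x, Finset.mul_sum]
  refine Finset.sum_le_sum fun i _ => ?_
  rw [h1, real_inner_comm (b i) x, Real.norm_eq_abs, sq_abs]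
  have h2 : lambdaMin hK ≤ hK.eigenvalues i := ciInf_le (Set.finite_range _).bddBelow i
  nlinarith [mul_le_mul_of_nonneg_right h2 (sq_nonneg (inner ℝ (b i) x))]

/-! ### Regularity of the energy and of the closed loop -/

theorem gradient_ofLp_apply {k : ℕ} (f : Vec k → ℝ) (x : Vec k) (i : Fin k) :
    gradient f x i = fderiv ℝ f x (EuclideanSpace.single i 1) := by
  rw [← InnerProductSpace.toDual_symm_apply, ← gradient, EuclideanSpace.inner_single_right]
  simp

namespace TargetData

variable {n m : ℕ} (S : TargetData n m)

theorem contDiff_Md_inv (i j : Fin n) : ContDiff ℝ 2 fun q => (S.Md q)⁻¹ i j :=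
  contDiff_matrix_inv S.Md_smooth (fun q => (S.Md_posDef q).det_pos.ne') i j

theorem contDiff_M_inv (i j : Fin n) : ContDiff ℝ 1 fun q => (S.M q)⁻¹ i j :=
  contDiff_matrix_inv S.M_smooth (fun q => (S.M_posDef q).det_pos.ne') i j

theorem transpose_Md_inv (q : Vec n) : ((S.Md q)⁻¹)ᵀ = (S.Md q)⁻¹ := by
  simpa using (S.Md_posDef q).inv.isHermitian.eq

theorem inner_Md_inv_pos (q : Vec n) {x : Vec n} (hx : x ≠ 0) :
    0 < inner ℝ x (mulE (S.Md q)⁻¹ x) := by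
  rw [inner_eq_dotProduct]
  have h0 : x.ofLp ≠ 0 := fun h => hx (by ext i; exact congrFun h i)
  simpa [mulE] using (S.Md_posDef q).inv.dotProduct_mulVec_pos h0

theorem inner_Md_inv_nonneg (q x : Vec n) : 0 ≤ inner ℝ x (mulE (S.Md q)⁻¹ x) := by
  rcases eq_or_ne x 0 with rfl | hx
  · simp
  · exact (S.inner_Md_inv_pos q hx).le

theorem contDiff_Hd : ContDiff ℝ 2 fun x : Vec n × Vec n => S.Hd x.1 x.2 := by
  unfold Hd
  refine (contDiff_const.mul (ContDiff.inner ℝ contDiff_snd ?_)).add (S.Vd_smooth.comp contDiff_fst)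
  exact contDiff_mulE (fun i j => (S.contDiff_Md_inv i j).comp contDiff_fst) contDiff_snd

theorem gradient_Hd_momentum (q p : Vec n) :
    gradient (fun p' => S.Hd q p') p = mulE (S.Md q)⁻¹ p := by
  refine HasGradientAt.gradient ?_
  rw [hasGradientAt_iff_hasFDerivAt]
  have h1 := ((hasFDerivAt_id p).inner ℝ (mulCLM (S.Md q)⁻¹).hasFDerivAt)
  have h2 := (h1.const_mul (1 / 2)).add_const (S.Vd q)
  refine h2.congr_fderiv ?_
  ext v
  have h3 : inner ℝ p (mulE (S.Md q)⁻¹ v) = inner ℝ (mulE (S.Md q)⁻¹ p) v := by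
    rw [inner_mulE_right, transpose_Md_inv]
  simp [fderivInnerCLM_apply, mulCLM_apply, h3, real_inner_comm v]
  ring

theorem contDiff_gradient_Hd_position :
    ContDiff ℝ 1 fun x : Vec n × Vec n => gradient (fun q' => S.Hd q' x.2) x.1 := by
  have h : ContDiff ℝ 1 fun x : Vec n × Vec n => fderiv ℝ (fun q' => S.Hd q' x.2) x.1 := by
    refine ContDiff.fderiv (f := fun (x : Vec n × Vec n) (q' : Vec n) => S.Hd q' x.2) (m := 2)
      ?_ contDiff_fst (by norm_num)
    exact ContDiff.comp (g := fun x : Vec n × Vec n => S.Hd x.1 x.2)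
      (f := fun y : (Vec n × Vec n) × Vec n => (y.2, y.1.2)) S.contDiff_Hd
      (contDiff_snd.prodMk (contDiff_snd.comp contDiff_fst))
  rw [contDiff_euclidean]
  intro i
  simp only [gradient_ofLp_apply]
  exact h.clm_apply contDiff_const

theorem contDiff_Htilde (r : ℕ) : ContDiff ℝ 2 fun x : State n r => S.Htilde x := by
  unfold Htilde
  refine (S.contDiff_Hd.comp (contDiff_fst.prodMk (contDiff_fst.comp contDiff_snd))).add
    (contDiff_const.mul (ContDiff.norm_sq ℝ (contDiff_snd.comp contDiff_snd)))

theorem fderiv_Htilde_apply {r : ℕ} (x v : State n r) :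
    fderiv ℝ (fun x : State n r => S.Htilde x) x v = stack (S.gradHtilde x) ⬝ᵥ stack v := by
  have hd : ∀ x, DifferentiableAt ℝ (fun x : State n r => S.Htilde x) x :=
    (S.contDiff_Htilde r).differentiable two_ne_zero
  obtain ⟨a, b, c⟩ := x
  obtain ⟨va, vb, vc⟩ := v
  have hH := (hd (a, b, c)).hasFDerivAt
  set D := fderiv ℝ (fun x : State n r => S.Htilde x) (a, b, c)
  have h1 : inner ℝ (gradient (fun a' => S.Htilde (a', b, c)) a) va = D (va, 0, 0) := by
    have := HasFDerivAt.comp (g := fun x : State n r => S.Htilde x)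
      (f := fun a' => ((a', b, c) : State n r)) a hH
      ((hasFDerivAt_id a).prodMk (hasFDerivAt_const (b, c) a))
    rw [gradient, InnerProductSpace.toDual_symm_apply]
    exact congrArg (fun L : Vec n →L[ℝ] ℝ => L va) this.fderiv
  have h2 : inner ℝ (gradient (fun b' => S.Htilde (a, b', c)) b) vb = D (0, vb, 0) := by
    have := HasFDerivAt.comp (g := fun x : State n r => S.Htilde x)
      (f := fun b' => ((a, b', c) : State n r)) b hH ((hasFDerivAt_const a b).prodMk
      ((hasFDerivAt_id b).prodMk (hasFDerivAt_const c b)))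
    rw [gradient, InnerProductSpace.toDual_symm_apply]
    exact congrArg (fun L : Vec n →L[ℝ] ℝ => L vb) this.fderiv
  have h3 : inner ℝ (gradient (fun c' => S.Htilde (a, b, c')) c) vc = D (0, 0, vc) := by
    have := HasFDerivAt.comp (g := fun x : State n r => S.Htilde x)
      (f := fun c' => ((a, b, c') : State n r)) c hH ((hasFDerivAt_const a c).prodMk
      ((hasFDerivAt_const b c).prodMk (hasFDerivAt_id c)))
    rw [gradient, InnerProductSpace.toDual_symm_apply]
    exact congrArg (fun L : Vec r →L[ℝ] ℝ => L vc) this.fderiv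
  have h4 : D (va, vb, vc) = D (va, 0, 0) + (D (0, vb, 0) + D (0, 0, vc)) := by
    rw [← map_add, ← map_add]
    simp
  rw [h4, ← h1, ← h2, ← h3]
  simp only [inner_eq_dotProduct, stack, TargetData.gradHtilde, sumElim_dotProduct_sumElim]

theorem gradHtilde_momentum {r : ℕ} (x : State n r) :
    (S.gradHtilde x).2.1 = mulE (S.Md x.1)⁻¹ x.2.1 := by
  rw [← S.gradient_Hd_momentum]
  simp only [TargetData.gradHtilde, TargetData.Htilde, gradient]
  rw [fderiv_add_const]

theorem Vd_sub_nonneg (q : Vec n) : 0 ≤ S.Vd q - S.Vd S.qstar := by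
  rcases eq_or_ne q S.qstar with rfl | hq
  · simp
  · linarith [S.qstar_argmin q hq]

/-- On a compact set of positions the kinetic energy is uniformly positive definite. -/
theorem exists_mul_norm_sq_le_inner_Md_inv {Q : Set (Vec n)} (hQ : IsCompact Q) :
    ∃ μ : ℝ, 0 < μ ∧ ∀ q ∈ Q, ∀ x : Vec n, μ * ‖x‖ ^ 2 ≤ inner ℝ x (mulE (S.Md q)⁻¹ x) := by
  let φ : Vec n × Vec n → ℝ := fun y => inner ℝ y.2 (mulE (S.Md y.1)⁻¹ y.2)
  have hφ : Continuous φ := by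
    have : ContDiff ℝ 2 φ := ContDiff.inner ℝ contDiff_snd
      (contDiff_mulE (fun i j => (S.contDiff_Md_inv i j).comp contDiff_fst) contDiff_snd)
    exact this.continuous
  have hK : IsCompact (Q ×ˢ Metric.sphere (0 : Vec n) 1) := hQ.prod (isCompact_sphere 0 1)
  obtain ⟨μ, hμ, H⟩ := hK.exists_forall_le' hφ.continuousOn (a := 0) fun y hy =>
    S.inner_Md_inv_pos y.1 (ne_zero_of_mem_unit_sphere ⟨y.2, hy.2⟩)
  refine ⟨μ, hμ, fun q hq x => ?_⟩
  rcases eq_or_ne x 0 with rfl | hx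
  · simp
  have hx' : 0 < ‖x‖ := norm_pos_iff.2 hx
  have h1 := H (q, ‖x‖⁻¹ • x) ⟨hq, by simp [norm_smul, hx'.ne']⟩
  have h2 : φ (q, ‖x‖⁻¹ • x) = ‖x‖⁻¹ * (‖x‖⁻¹ * inner ℝ x (mulE (S.Md q)⁻¹ x)) := by
    simp only [φ, ← mulCLM_apply, map_smul, real_inner_smul_left, real_inner_smul_right]
  rw [h2] at h1
  have h3 := mul_le_mul_of_nonneg_right h1 (sq_nonneg ‖x‖)
  convert! h3 using 1
  field_simp

end TargetData

namespace Controller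

variable {n m r : ℕ} (C : Controller n m r) (S : TargetData n m)

theorem contDiff_coord : ContDiff ℝ 1 C.coord := by
  refine contDiff_fst.prodMk (((contDiff_fst.comp contDiff_snd).add ?_).prodMk
    (contDiff_snd.comp contDiff_snd))
  exact contDiff_mulE (fun i j => (C.K_smooth i j).comp contDiff_fst)
    (contDiff_snd.comp contDiff_snd)

theorem contDiff_closedLoop_zero : ContDiff ℝ 1 fun z => C.closedLoop S z 0 := by
  have hp : ContDiff ℝ 1 fun z : State n r => z.2.1 := contDiff_fst.comp contDiff_snd
  have hgp : ContDiff ℝ 1 fun z : State n r => gradient (fun p' => S.Hd z.1 p') z.2.1 := by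
    simp only [S.gradient_Hd_momentum]
    exact contDiff_mulE (fun i j => ((S.contDiff_Md_inv i j).of_le (by norm_num)).comp contDiff_fst)
      hp
  have hgq : ContDiff ℝ 1 fun z : State n r => gradient (fun q' => S.Hd q' z.2.1) z.1 :=
    ContDiff.comp (g := fun x : Vec n × Vec n => gradient (fun q' => S.Hd q' x.2) x.1)
      (f := fun z : State n r => (z.1, z.2.1)) S.contDiff_gradient_Hd_position
      (contDiff_fst.prodMk hp)
  have hMd : ∀ i j, ContDiff ℝ 1 fun z : State n r => S.Md z.1 i j := fun i j =>
    ((S.Md_smooth i j).of_le (by norm_num)).comp contDiff_fst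
  have hMi : ∀ i j, ContDiff ℝ 1 fun z : State n r => (S.M z.1)⁻¹ i j := fun i j =>
    (S.contDiff_M_inv i j).comp contDiff_fst
  have hG : ∀ i j, ContDiff ℝ 1 fun z : State n r => S.G z.1 i j := fun i j =>
    (S.G_smooth i j).comp contDiff_fst
  have hJ : ∀ i j, ContDiff ℝ 1 fun z : State n r => S.J₂ z.1 z.2.1 i j := fun i j =>
    ContDiff.comp (g := fun x : Vec n × Vec n => S.J₂ x.1 x.2 i j)
      (f := fun z : State n r => (z.1, z.2.1)) (S.J₂_smooth i j) (contDiff_fst.prodMk hp)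
  have hGKG : ∀ i j, ContDiff ℝ 1 fun z : State n r =>
      (S.G z.1 * S.KP * (S.G z.1)ᵀ) i j := fun i j =>
    contDiff_matrix_mul (A := fun z : State n r => S.G z.1 * S.KP)
      (B := fun z : State n r => (S.G z.1)ᵀ)
      (contDiff_matrix_mul (B := fun _ : State n r => S.KP) hG fun _ _ => contDiff_const)
      (fun i j => hG j i) i j
  have h1 : ContDiff ℝ 1 fun z : State n r =>
      mulE ((S.M z.1)⁻¹ * S.Md z.1) (gradient (fun p' => S.Hd z.1 p') z.2.1) :=
    contDiff_mulE (contDiff_matrix_mul hMi hMd) hgp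
  have h2 : ContDiff ℝ 1 fun z : State n r =>
      mulE (-(S.Md z.1 * (S.M z.1)⁻¹)) (gradient (fun q' => S.Hd q' z.2.1) z.1) :=
    contDiff_mulE (fun i j => (contDiff_matrix_mul hMd hMi i j).neg) hgq
  have h3 : ContDiff ℝ 1 fun z : State n r =>
      mulE (S.J₂ z.1 z.2.1 - S.G z.1 * S.KP * (S.G z.1)ᵀ)
        (gradient (fun p' => S.Hd z.1 p') z.2.1) :=
    contDiff_mulE (fun i j => (hJ i j).sub (hGKG i j)) hgp
  have h4 : ContDiff ℝ 1 fun z : State n r => mulE (S.G z.1) (C.β z) :=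
    contDiff_mulE hG C.β_smooth
  have h5 : ContDiff ℝ 1 fun z : State n r => mulE (S.G z.1) 0 :=
    contDiff_mulE hG contDiff_const
  exact (h1.add contDiff_const).prodMk ((((h2.add h3).add h4).add h5).prodMk C.F_smooth)

/-- The matched disturbance enters the closed loop through `d ↦ (0, G(q) d, 0)`. -/
noncomputable def disturbanceMap (r : ℕ) (S : TargetData n m) (z : State n r) :
    Vec m →L[ℝ] State n r :=
  (ContinuousLinearMap.inr ℝ (Vec n) (Vec n × Vec r)).comp
    ((ContinuousLinearMap.inl ℝ (Vec n) (Vec r)).comp (mulCLM (S.G z.1)))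

theorem disturbanceMap_apply (z : State n r) (d : Vec m) :
    disturbanceMap r S z d = (0, mulE (S.G z.1) d, 0) := rfl

theorem contDiff_disturbanceMap : ContDiff ℝ 1 (disturbanceMap r S) := by
  rw [contDiff_clm_apply_iff]
  intro d
  simp only [disturbanceMap_apply]
  exact contDiff_const.prodMk ((contDiff_mulE (fun i j => (S.G_smooth i j).comp contDiff_fst)
    contDiff_const).prodMk contDiff_const)

theorem closedLoop_eq_affineField :
    C.closedLoop S = affineField (fun z => C.closedLoop S z 0) (disturbanceMap r S) := by
  funext z d
  have h0 : mulE (S.G z.1) 0 = 0 := (mulCLM (S.G z.1)).map_zero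
  simp [affineField, disturbanceMap_apply, closedLoop, TargetData.pdot, h0]

/-! ### The dissipation inequality -/

theorem fderiv_coord_momentum (z : State n r) (w : Vec n) :
    fderiv ℝ C.coord z (0, w, 0) = (0, w, 0) := by
  have h1 := (C.contDiff_coord.differentiable one_ne_zero z).hasFDerivAt
  have h2 := HasFDerivAt.comp (f := fun p : Vec n => ((z.1, p, z.2.2) : State n r)) z.2.1 h1
    ((hasFDerivAt_const z.1 z.2.1).prodMk
      ((hasFDerivAt_id z.2.1).prodMk (hasFDerivAt_const z.2.2 z.2.1)))
  have h3 : HasFDerivAt (fun p : Vec n => C.coord (z.1, p, z.2.2)) ((0 : Vec n →L[ℝ] Vec n).prod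
      ((ContinuousLinearMap.id ℝ (Vec n)).prod 0)) z.2.1 :=
    (hasFDerivAt_const z.1 z.2.1).prodMk
      (((hasFDerivAt_id z.2.1).add_const (mulE (C.K z.1) z.2.2)).prodMk
        (hasFDerivAt_const z.2.2 z.2.1))
  exact congrArg (fun L : Vec n →L[ℝ] State n r => L w) (h2.unique h3)

theorem yp_eq (z : State n r) :
    C.yp S z = mulE (S.G z.1)ᵀ (mulE (S.Md z.1)⁻¹ (C.coord z).2.1) := by
  rw [yp, mulE_mul]

/-- The energy balance: the skew part does no work, the damping extracts `y_pᵀ K_v y_p`, and the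
disturbance supplies `y_pᵀ d`. -/
theorem fderiv_Htilde_coord_closedLoop {Kv : Matrix (Fin m) (Fin m) ℝ}
    {𝒥 : State n r → Matrix (Fin n ⊕ Fin n ⊕ Fin r) (Fin n ⊕ Fin n ⊕ Fin r) ℝ}
    (h𝒥 : ∀ x, (𝒥 x)ᵀ = -𝒥 x) (hmatch : C.SolvesMatching S Kv 𝒥) (z : State n r) (d : Vec m) :
    fderiv ℝ (fun z' => S.Htilde (C.coord z')) z (C.closedLoop S z d) =
      -inner ℝ (C.yp S z) (mulE Kv (C.yp S z)) + inner ℝ (C.yp S z) d := by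
  have hc := C.contDiff_coord.differentiable one_ne_zero z
  have hH : DifferentiableAt ℝ (fun x : State n r => S.Htilde x) (C.coord z) :=
    (S.contDiff_Htilde r).differentiable two_ne_zero _
  have e : fderiv ℝ (fun z' => S.Htilde (C.coord z')) z =
      (fderiv ℝ (fun x : State n r => S.Htilde x) (C.coord z)).comp (fderiv ℝ C.coord z) :=
    fderiv_comp z hH hc
  rw [e, C.closedLoop_eq_affineField S, affineField, ContinuousLinearMap.comp_apply, map_add,
    map_add, disturbanceMap_apply, C.fderiv_coord_momentum, S.fderiv_Htilde_apply,
    S.fderiv_Htilde_apply, hmatch z, Matrix.sub_mulVec, dotProduct_sub,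
    dotProduct_mulVec_self_of_skew (h𝒥 _)]
  have hb := S.gradHtilde_momentum (C.coord z)
  have hq : (C.coord z).1 = z.1 := rfl
  rw [hq] at hb
  generalize S.gradHtilde (C.coord z) = v at hb
  obtain ⟨va, vb, vc⟩ := v
  simp only at hb
  have hy : C.yp S z = mulE (S.G z.1)ᵀ vb := by rw [C.yp_eq S, hb]
  have e1 : stack (va, vb, vc) ⬝ᵥ stack (n := n) (r := r) (0, mulE (S.G z.1) d, 0) =
      inner ℝ (C.yp S z) d := by
    rw [hy, ← inner_mulE_right, inner_eq_dotProduct]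
    simp [stack, sumElim_dotProduct_sumElim]
  have e2 : stack (va, vb, vc) ⬝ᵥ S.damping r Kv z.1 *ᵥ stack (va, vb, vc) =
      inner ℝ (C.yp S z) (mulE Kv (C.yp S z)) := by
    rw [hy, ← inner_mulE_right, ← mulE_mul, ← mulE_mul, inner_eq_dotProduct]
    simp [stack, TargetData.damping, Matrix.fromBlocks_mulVec, sumElim_dotProduct_sumElim,
      mulE, Function.comp_def]
  rw [e1, e2]
  ring

theorem dissipation_inequality {Kv : Matrix (Fin m) (Fin m) ℝ} (hKv : Kv.PosDef)
    {𝒥 : State n r → Matrix (Fin n ⊕ Fin n ⊕ Fin r) (Fin n ⊕ Fin n ⊕ Fin r) ℝ}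
    (h𝒥 : ∀ x, (𝒥 x)ᵀ = -𝒥 x) (hmatch : C.SolvesMatching S Kv 𝒥) (z : State n r) (d : Vec m) :
    fderiv ℝ (fun z' => S.Htilde (C.coord z')) z (C.closedLoop S z d) ≤
      -(1 / 2) * lambdaMin hKv.isHermitian * ‖C.yp S z‖ ^ 2
        + 1 / (2 * lambdaMin hKv.isHermitian) * ‖d‖ ^ 2 := by
  rw [C.fderiv_Htilde_coord_closedLoop S h𝒥 hmatch]
  have h1 := lambdaMin_mul_norm_sq_le hKv.isHermitian (C.yp S z)
  have h2 := real_inner_le_norm (C.yp S z) d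
  rcases isEmpty_or_nonempty (Fin m) with hm | hm
  · -- without inputs both sides vanish
    have hy : C.yp S z = 0 := Subsingleton.elim _ _
    have hd : d = 0 := Subsingleton.elim _ _
    simp [hy, hd]
  · have hl := lambdaMin_pos hKv
    set l := lambdaMin hKv.isHermitian
    -- Young's inequality
    have h3 : ‖C.yp S z‖ * ‖d‖ ≤ 1 / 2 * l * ‖C.yp S z‖ ^ 2 + 1 / (2 * l) * ‖d‖ ^ 2 := by
      have : 1 / 2 * l * ‖C.yp S z‖ ^ 2 + 1 / (2 * l) * ‖d‖ ^ 2 - ‖C.yp S z‖ * ‖d‖ =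
          (l * ‖C.yp S z‖ - ‖d‖) ^ 2 / (2 * l) := by
        field_simp
        ring
      have h4 : 0 ≤ (l * ‖C.yp S z‖ - ‖d‖) ^ 2 / (2 * l) := by positivity
      linarith
    linarith

/-! ### The energy as a proper storage function -/

theorem Htilde_coord_sub (z : State n r) :
    S.Htilde (C.coord z) - S.Vd S.qstar =
      1 / 2 * inner ℝ (C.coord z).2.1 (mulE (S.Md z.1)⁻¹ (C.coord z).2.1)
        + (S.Vd z.1 - S.Vd S.qstar) + 1 / 2 * ‖z.2.2‖ ^ 2 := by
  simp only [TargetData.Htilde, TargetData.Hd, coord]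
  ring

theorem Htilde_coord_sub_eq_zero_iff (z : State n r) :
    S.Htilde (C.coord z) - S.Vd S.qstar = 0 ↔ z = (S.qstar, 0, 0) := by
  rw [C.Htilde_coord_sub S]
  constructor
  · intro h
    have h1 := S.inner_Md_inv_nonneg z.1 (C.coord z).2.1
    have h2 := S.Vd_sub_nonneg z.1
    have h3 : 0 ≤ ‖z.2.2‖ ^ 2 := sq_nonneg _
    have hq : z.1 = S.qstar := by
      by_contra hq
      linarith [S.qstar_argmin z.1 hq]
    have hv : z.2.2 = 0 := by
      have : ‖z.2.2‖ ^ 2 = 0 := by linarith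
      simpa using this
    have hp : (C.coord z).2.1 = 0 := by
      by_contra hp
      linarith [S.inner_Md_inv_pos z.1 hp]
    have hp' : z.2.1 = 0 := by
      have h0 : mulE (C.K z.1) 0 = 0 := (mulCLM (C.K z.1)).map_zero
      simpa [coord, hv, h0] using hp
    exact Prod.ext hq (Prod.ext hp' hv)
  · rintro rfl
    have h0 : mulE (C.K S.qstar) 0 = 0 := (mulCLM (C.K S.qstar)).map_zero
    simp [coord, h0]

theorem isCompact_Htilde_coord_sublevel (hVd : Tendsto S.Vd (cocompact (Vec n)) atTop) (c : ℝ) :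
    IsCompact {z | S.Htilde (C.coord z) - S.Vd S.qstar ≤ c} := by
  have hcont : Continuous fun z => S.Htilde (C.coord z) - S.Vd S.qstar :=
    ((S.contDiff_Htilde r).continuous.comp C.contDiff_coord.continuous).sub continuous_const
  obtain ⟨Q, hQ, hQV⟩ := mem_cocompact.1 (hVd (Ioi_mem_atTop (c + S.Vd S.qstar)))
  obtain ⟨μ, hμ, H⟩ := S.exists_mul_norm_sq_le_inner_Md_inv hQ
  -- the sublevel set lies in the image of a product of compact sets in the coordinates `x`
  let ψ : State n r → State n r := fun x => (x.1, x.2.1 - mulE (C.K x.1) x.2.2, x.2.2)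
  have hψ : Continuous ψ := by
    have : Continuous fun x : State n r => mulE (C.K x.1) x.2.2 :=
      (contDiff_mulE (fun i j => (C.K_smooth i j).comp contDiff_fst)
        (contDiff_snd.comp contDiff_snd)).continuous
    fun_prop
  have hK : IsCompact (ψ '' (Q ×ˢ (Metric.closedBall (0 : Vec n) √(2 * c / μ) ×ˢ
      Metric.closedBall (0 : Vec r) √(2 * c)))) :=
    (hQ.prod ((isCompact_closedBall _ _).prod (isCompact_closedBall _ _))).image hψ
  refine hK.of_isClosed_subset (isClosed_le hcont continuous_const) fun z hz => ?_
  have hz' : S.Htilde (C.coord z) - S.Vd S.qstar ≤ c := hz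
  rw [C.Htilde_coord_sub S] at hz'
  have h1 := S.inner_Md_inv_nonneg z.1 (C.coord z).2.1
  have h2 := S.Vd_sub_nonneg z.1
  have h3 : 0 ≤ ‖z.2.2‖ ^ 2 := sq_nonneg _
  have hzQ : z.1 ∈ Q := by
    by_contra hzQ
    have : c + S.Vd S.qstar < S.Vd z.1 := hQV hzQ
    linarith
  refine ⟨C.coord z, ⟨hzQ, ?_, ?_⟩, ?_⟩
  · rw [mem_closedBall_zero_iff]
    refine Real.le_sqrt_of_sq_le ?_
    rw [le_div_iff₀ hμ]
    linarith [H z.1 hzQ (C.coord z).2.1]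
  · rw [mem_closedBall_zero_iff]
    refine Real.le_sqrt_of_sq_le ?_
    have : (C.coord z).2.2 = z.2.2 := rfl
    rw [this]
    linarith
  · simp [ψ, coord]

theorem continuous_yp : Continuous (C.yp S) := by
  have h := C.contDiff_coord
  have : ContDiff ℝ 1 (C.yp S) := by
    refine contDiff_mulE (fun i j => contDiff_matrix_mul
      (fun i j => (S.G_smooth j i).comp contDiff_fst)
      (fun i j => ((S.contDiff_Md_inv i j).of_le (by norm_num)).comp contDiff_fst) i j) ?_
    exact contDiff_fst.comp (contDiff_snd.comp h)
  exact this.continuous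

theorem isProperStorage {Kv : Matrix (Fin m) (Fin m) ℝ} (hKv : Kv.PosDef)
    {𝒥 : State n r → Matrix (Fin n ⊕ Fin n ⊕ Fin r) (Fin n ⊕ Fin n ⊕ Fin r) ℝ}
    (h𝒥 : ∀ x, (𝒥 x)ᵀ = -𝒥 x) (hmatch : C.SolvesMatching S Kv 𝒥)
    (hVd : Tendsto S.Vd (cocompact (Vec n)) atTop) :
    IsProperStorage (fun z => C.closedLoop S z 0) (disturbanceMap r S)
      (fun z => S.Htilde (C.coord z) - S.Vd S.qstar)
      (fun z => 1 / 2 * lambdaMin hKv.isHermitian * ‖C.yp S z‖ ^ 2)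
      (1 / (2 * lambdaMin hKv.isHermitian)) where
  contDiff_drift := C.contDiff_closedLoop_zero S
  contDiff_input := contDiff_disturbanceMap S
  contDiff_storage :=
    (((S.contDiff_Htilde r).of_le (by norm_num)).comp C.contDiff_coord).sub contDiff_const
  continuous_rate := continuous_const.mul ((C.continuous_yp S).norm.pow 2)
  storage_nonneg z := by
    rw [C.Htilde_coord_sub S]
    have h1 := S.inner_Md_inv_nonneg z.1 (C.coord z).2.1
    have h2 := S.Vd_sub_nonneg z.1
    positivity
  rate_nonneg z := by
    have := lambdaMin_nonneg hKv
    positivity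
  const_nonneg := by
    have := lambdaMin_nonneg hKv
    positivity
  isCompact_sublevel := C.isCompact_Htilde_coord_sublevel S hVd
  dissipation z d := by
    rw [fderiv_sub_const, ← C.closedLoop_eq_affineField S]
    refine (C.dissipation_inequality S hKv h𝒥 hmatch z d).trans_eq ?_
    ring

theorem isRateDetectable {Kv : Matrix (Fin m) (Fin m) ℝ} (hKv : Kv.PosDef)
    {ze : State n r} (hdet : IsDetectable (C.closedLoop S) (C.yp S) ze) :
    IsRateDetectable (fun z => C.closedLoop S z 0) (disturbanceMap r S)
      (fun z => 1 / 2 * lambdaMin hKv.isHermitian * ‖C.yp S z‖ ^ 2) ze := by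
  intro z hz hρ
  rw [← C.closedLoop_eq_affineField S] at hz
  refine hdet z hz fun t ht => ?_
  rcases isEmpty_or_nonempty (Fin m) with hm | hm
  · exact Subsingleton.elim _ _
  · have hl := lambdaMin_pos hKv
    simpa [hl.ne'] using hρ t ht

end Controller

/-! ### Energy dissipation and stability of the closed loop -/

theorem continuous_stateNorm {n r : ℕ} : Continuous (stateNorm : State n r → ℝ) := by
  unfold stateNorm
  fun_prop

theorem norm_le_stateNorm {n r : ℕ} (z : State n r) : ‖z‖ ≤ stateNorm z := by
  have h1 := sq_nonneg ‖z.1‖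
  have h2 := sq_nonneg ‖z.2.1‖
  have h3 := sq_nonneg ‖z.2.2‖
  refine max_le ?_ (max_le ?_ ?_) <;> refine Real.le_sqrt_of_sq_le ?_ <;> linarith

theorem mainTheorem5 {n m r : ℕ} (S : TargetData n m) (C : Controller n m r)
    (Kv : Matrix (Fin m) (Fin m) ℝ) (hKv : Kv.PosDef)
    (𝒥 : State n r → Matrix (Fin n ⊕ Fin n ⊕ Fin r) (Fin n ⊕ Fin n ⊕ Fin r) ℝ)
    (h𝒥 : ∀ x, (𝒥 x)ᵀ = -𝒥 x)
    (hmatch : C.SolvesMatching S Kv 𝒥) :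
    -- the dissipation inequality, as a derivative along the closed-loop vector field
    (∀ (z : State n r) (d : Vec m),
      fderiv ℝ (fun z' => S.Htilde (C.coord z')) z (C.closedLoop S z d) ≤
        -(1 / 2) * lambdaMin hKv.isHermitian * ‖C.yp S z‖ ^ 2
          + 1 / (2 * lambdaMin hKv.isHermitian) * ‖d‖ ^ 2) ∧
    -- the dissipation inequality along solutions, at almost every time
    (∀ (d : ℝ → Vec m), AdmissibleInput d →
      ∀ z : ℝ → State n r, IsSolution (C.closedLoop S) d z →
        ∀ᵐ t ∂(volume.restrict (Ici (0 : ℝ))), ∃ h : ℝ,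
          HasDerivAt (fun s => S.Htilde (C.coord (z s))) h t ∧
          h ≤ -(1 / 2) * lambdaMin hKv.isHermitian * ‖C.yp S (z t)‖ ^ 2
            + 1 / (2 * lambdaMin hKv.isHermitian) * ‖d t‖ ^ 2) ∧
    -- integral input-to-state stability under detectability
    (Tendsto S.Vd (cocompact (Vec n)) atTop →
      IsDetectable (C.closedLoop S) (C.yp S) (S.qstar, 0, 0) →
      IsIISS (C.closedLoop S) stateNorm (S.qstar, 0, 0)) := by
  refine ⟨C.dissipation_inequality S hKv h𝒥 hmatch, fun d hd z hz => ?_, fun hVd hdet => ?_⟩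
  · have hz' := hz
    rw [C.closedLoop_eq_affineField S] at hz'
    have hder : ∀ᵐ t, t ∈ Ioi (0 : ℝ) → HasDerivAt z (C.closedLoop S (z t) (d t)) t := by
      have h1 : ∀ N : ℕ, ∀ᵐ t, t ∈ Ioo (0 : ℝ) N → HasDerivAt z (C.closedLoop S (z t) (d t)) t := by
        intro N
        have := (hz'.isSolutionOn N).ae_hasDerivAt (C.contDiff_closedLoop_zero S).continuous
          (Controller.contDiff_disturbanceMap S).continuous hd
        rwa [← C.closedLoop_eq_affineField S] at this
      filter_upwards [ae_all_iff.2 h1] with t ht h0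
      obtain ⟨N, hN⟩ := exists_nat_gt t
      exact ht N ⟨h0, hN⟩
    rw [← restrict_Ioi_eq_restrict_Ici, ae_restrict_iff' measurableSet_Ioi]
    filter_upwards [hder] with t ht h0
    have hV : DifferentiableAt ℝ (fun z' => S.Htilde (C.coord z')) (z t) :=
      (((S.contDiff_Htilde r).of_le (by norm_num)).comp C.contDiff_coord).differentiable
        one_ne_zero _
    exact ⟨_, hV.hasFDerivAt.comp_hasDerivAt t (ht h0),
      C.dissipation_inequality S hKv h𝒥 hmatch _ _⟩
  · rw [C.closedLoop_eq_affineField S]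
    exact (C.isProperStorage S hKv h𝒥 hmatch hVd).isIISS (C.Htilde_coord_sub_eq_zero_iff S)
      (C.isRateDetectable S hKv hdet) continuous_stateNorm (by simp [stateNorm]) norm_le_stateNorm
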